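/- Let $0<q<1$, $\sigma=q-q^{-1}$, $\zeta=q^{-1/2}$, and let $R=(R_i{}^j{}_k{}^l)_{i,j,k,l\in\{1,2\}}$ have the non-zero entries $R_1{}^1{}_1{}^1=R_2{}^2{}_2{}^2=q$, $R_1{}^1{}_2{}^2=R_2{}^2{}_1{}^1=1$, $R_2{}^1{}_1{}^2=\sigma$. Repeated Greek indices are summed. **Quantum groups.** $H=\mathcal A[\mathrm{SU}_q(2)]$ is the algebra generated by the entries of $(a_i{}^j)=\begin{pmatrix}a&b\\c&d\end{pmatrix}$ with $ab=qba$, $ac=qca$, $bd=qdb$, $cd=qdc$, $bc=cb$, $ad-da=\sigma bc$, $ad-qbc=1$, antipode $S\begin{pmatrix}a&b\\c&d\end{pmatrix}=\begin{pmatrix}d&-q^{-1}b\\-qc&a\end{pmatrix}$ and matrix coproduct. $\widetilde H=\mathcal A[\mathrm{SU}_q^{\rm cop}(2)]$ is the same algebra with opposite coproduct and antipode $\widetilde S=S^{-1}$. $H'=\mathcal A[\mathrm U(1)]=\mathbb C[t,t^{-1}]$, and $\pi:\widetilde H\to H'$ is given by $a\mapsto t$, $d\mapsto t^{-1}$, $b,c\mapsto0$.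 **The total space.** Let $F$ be the free algebra on the entries of a $4\times4$ matrix $A=\begin{pmatrix}\mathbf a&\mathbf b\\\mathbf c&\mathbf d\end{pmatrix}$ of $2\times2$ blocks. Write $(A_i{}^j)^*\in F$ for the elements determined by the requirement that each block have the form $\begin{pmatrix}x_1&-qx_2^*\\x_2&x_1^*\end{pmatrix}$. Let $I\subset F$ be the two-sided ideal of the following relations (for all free indices): * $R_i{}^\alpha{}_k{}^\beta\mathrm x_\alpha{}^j\mathrm x_\beta{}^l=\mathrm x_k{}^\beta\mathrm x_i{}^\alpha R_\alpha{}^j{}_\beta{}^l$ for $\mathrm x=\mathrm a,\mathrm b,\mathrm c,\mathrm d$; * for $(\mathrm x,\mathrm y)=(\mathrm a,\mathrm b)$ and $(\mathrm c,\mathrm d)$: $\mathrm y_i{}^1\mathrm x_k{}^j=\zeta R_k{}^\alpha{}_i{}^\beta\mathrm x_\alpha{}^j\mathrm y_\beta{}^1$ and $\mathrm x_i{}^j\mathrm y_k{}^2=\zeta R_k{}^\alpha{}_i{}^\beta\mathrm y_\alpha{}^2\mathrm x_\beta{}^j$; * for $(\mathrm x,\mathrm y)=(\mathrm a,\mathrm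 c)$ and $(\mathrm b,\mathrm d)$: $\mathrm x_1{}^i\mathrm y_j{}^k=\zeta\,\mathrm y_j{}^\beta\mathrm x_1{}^\alpha R_\alpha{}^i{}_\beta{}^k$ and $\mathrm y_j{}^i\mathrm x_2{}^k=\zeta\,\mathrm x_2{}^\beta\mathrm y_j{}^\alpha R_\alpha{}^i{}_\beta{}^k$; * $\mathrm c_1{}^j\mathrm b_i{}^1=\zeta^2\mathrm b_i{}^1\mathrm c_1{}^j$, $\ \mathrm c_2{}^j\mathrm b_i{}^2=\zeta^{-2}\mathrm b_i{}^2\mathrm c_2{}^j$, $\ \mathrm d_1{}^2\mathrm a_i{}^j=\zeta^2\mathrm a_i{}^j\mathrm d_1{}^2$, $\ \mathrm d_2{}^1\mathrm a_i{}^j=\zeta^{-2}\mathrm a_i{}^j\mathrm d_2{}^1$, $\ \mathrm d_1{}^1\mathrm a_i{}^j-\mathrm a_i{}^j\mathrm d_1{}^1=\zeta\sigma\,\mathrm b_i{}^1\mathrm c_1{}^j$, $\ \mathrm a_i{}^j\mathrm d_2{}^2-\mathrm d_2{}^2\mathrm a_i{}^j=\zeta\sigma\,\mathrm c_2{}^j\mathrm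 b_i{}^2$, $\ \mathrm c_1{}^j\mathrm b_i{}^2-\mathrm b_i{}^2\mathrm c_1{}^j=\zeta\sigma\,\mathrm a_i{}^j\mathrm d_1{}^2$, $\ \mathrm c_2{}^j\mathrm b_i{}^1-\mathrm b_i{}^1\mathrm c_2{}^j=\zeta\sigma\,\mathrm d_2{}^1\mathrm a_i{}^j$; * $(A_\mu{}^j)^*A_\mu{}^l=\delta_j^l$ and $A_j{}^\mu(A_l{}^\mu)^*=\delta_j^l$ for $j,l=1,\dots,4$. Let $\delta:F\to F\otimes(\widetilde H\otimes H)$ be the algebra map with $\mathrm x_i{}^j\mapsto\mathrm x_\mu{}^j\otimes(a_i{}^\mu\otimes1)$ for $\mathrm x=\mathrm a,\mathrm b$ and $\mathrm x_i{}^j\mapsto\mathrm x_\mu{}^j\otimes(1\otimes S(u_i{}^\mu))$ for $\mathrm x=\mathrm c,\mathrm d$, where $u=\begin{pmatrix}a_2{}^2&-a_2{}^1\\-a_1{}^2&a_1{}^1\end{pmatrix}$. Put $P=\mathcal A[\mathrm{Sp}_q(2)]:=F/J$, where $J\subseteq I$ is the largest two-sided ideal contained in $I$ to whose quotient $F/J$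 the coaction $\delta$ descends (so $J=I$ if $\delta$ descends to $F/I$). Thus $P$ is a right $\widetilde H\otimes H$-comodule algebra, and through $\pi\otimes\mathrm{id}$ a right $H'\otimes H$-comodule algebra. For a comodule $V$ write $\mathcal M(V)=(P\otimes V)^{\rm co}$ for the coinvariants in the right tensor product comodule. **Two-forms on $S^4_q$.** Let $V_{1/2}=\mathrm{span}(x,y)$ with $(x\ y)\mapsto(x\ y)\otimes\begin{pmatrix}a&b\\c&d\end{pmatrix}$ over $H$, and $\widetilde V_{1/2}=\mathrm{span}(\tilde x,\tilde y)$ with $(\tilde x\ \tilde y)\mapsto(\tilde x\ \tilde y)\otimes\widetilde S\begin{pmatrix}a&b\\c&d\end{pmatrix}$ over $\widetilde H$. Their braidings are $\Psi(x\otimes x)=q^{1/2}x\otimes x$, $\Psi(x\otimes y)=\zeta(y\otimes x+\sigma x\otimes y)$, $\Psi(y\otimes x)=\zeta\,x\otimes y$, $\Psi(y\otimes y)=q^{1/2}y\otimes y$, and $\widetilde\Psi(\tilde x\otimes\tilde x)=q^{1/2}\tilde x\otimes\tilde x$, $\widetilde\Psi(\tilde x\otimes\tilde y)=\zeta\,\tilde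 y\otimes\tilde x$, $\widetilde\Psi(\tilde y\otimes\tilde x)=\zeta(\tilde x\otimes\tilde y+\sigma\tilde y\otimes\tilde x)$, $\widetilde\Psi(\tilde y\otimes\tilde y)=q^{1/2}\tilde y\otimes\tilde y$. Let $V=\widetilde V_{1/2}\otimes V_{1/2}$, let $\Phi$ be the braiding on $V\otimes V$ given by $\widetilde\Psi\otimes\Psi$ after exchange of the two inner factors, and let $V^{\wedge2}$ be its eigenspace for $-q^{-1}$. Put $\Omega^2S^4_q=\mathcal M(V^{\wedge2})$. A two-form is *anti-self-dual* if it lies in $\Omega^2_-S^4_q=\mathcal M(\widetilde V_0\otimes V_1)$, where $\widetilde V_0\subset\widetilde V_{1/2}^{\otimes2}$ is the spin $0$ component (the $-q^{-3/2}$-eigenspace of $\widetilde\Psi$) and $V_1\subset V_{1/2}^{\otimes2}$ the spin $1$ component (the $q^{1/2}$-eigenspace of $\Psi$). **Two-forms on $\mathbb{CP}^3_q$.** Let $U_k=\mathbb C$ with $H'$-coaction $u\mapsto u\otimes t^k$, let $V_0=\mathbb C$ be the trivial $H$-comodule, and let $\widehat V=(U_2\otimes V_0)\oplus(U_1\otimes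 V_{1/2})\oplus(U_0\otimes V_0)\oplus(U_{-1}\otimes V_{1/2})\oplus(U_{-2}\otimes V_0)$, with $T_+,T_0,T_-$ the parts of positive, zero, negative weight. Let $\widehat\Phi$ be the braiding on $\widehat V\otimes\widehat V$ which flips the $\mathrm U(1)$-parts, is $\Psi$ on $V_{1/2}\otimes V_{1/2}$, and is the flip where a factor $V_0$ occurs. It is diagonalizable with eigenvalues $\pm1,\pm q^{1/2},\pm q^{-3/2}$. Let $\widehat V^{\wedge2}$ be the (21-dimensional) sum of its eigenspaces with negative eigenvalue, and let $v\wedge_qw$ be the projection of $v\otimes w$ to $\widehat V^{\wedge2}$ along the other eigenspaces. Put $\Omega^2\mathbb{CP}^3_q=\mathcal M(\widehat V^{\wedge2})$, the coinvariants being taken for $H'\otimes H$. A two-form on $\mathbb{CP}^3_q$ has *type* $(m,a,n)$ if it lies in $P\otimes\widehat V^{m,a,n}$, where $\widehat V^{m,a,n}$ is the span of the products $v\wedge_qw$ of $m$ elements of $T_+$, $a$ of $T_0$ and $n$ of $T_-$, in any order. **The push-out.** Let $j:V\to\widehat V$ be the inclusion of $V$ as $(U_1\otimes V_{1/2})\oplus(U_{-1}\otimes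 V_{1/2})$, with $\tilde x\in U_{-1}$, $\tilde y\in U_1$; let $j_*:V^{\wedge2}\to\widehat V^{\wedge2}$ be $j\otimes j$ followed by the projection to $\widehat V^{\wedge2}$, and let $\eta_*=\mathrm{id}_P\otimes j_*$. **Proposition.** For every $\omega\in\Omega^2S^4_q$ one has $\eta_*\omega\in\Omega^2\mathbb{CP}^3_q$, and $\omega$ is anti-self-dual if and only if $\eta_*\omega$ is a two-form of type $(1,0,1)$. -/

import Mathlib

open scoped TensorProduct

noncomputable section

namespace QTwistor

/-! ### The `R`-matrix and the quantum group `SU_q(2)` -/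

/-- The numbers `q^{1/2}`, and `ζ = q^{-1/2}`, as complex numbers. -/
def sqrtq (q : ℝ) : ℂ := ((Real.sqrt q : ℝ) : ℂ)

/-- The normalisation factor `ζ = q^{-1/2}`. -/
def zeta (q : ℝ) : ℂ := (sqrtq q)⁻¹

/-- The number `σ = q - q⁻¹`. -/
def sig (q : ℝ) : ℂ := (q : ℂ) - (q : ℂ)⁻¹

/-- The entries `R_i^j_k^l` of the `R`-matrix (row `(i,k)`, column `(j,l)`; the indices `1, 2` are
written `0, 1`). -/
def Rmat (q : ℝ) (i j k l : Fin 2) : ℂ :=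
  if i = j ∧ k = l then (if i = k then (q : ℂ) else 1)
  else if i = 1 ∧ j = 0 ∧ k = 0 ∧ l = 1 then sig q else 0

/-- The generators `a, b, c, d` of `SU_q(2)`, as the entries `a_i^j` of a `2 × 2` matrix in the free
algebra. -/
def suGen (i j : Fin 2) : FreeAlgebra ℂ (Fin 2 × Fin 2) := FreeAlgebra.ι ℂ (i, j)

/-- The relations of `SU_q(2)`, with `a = a_1^1`, `b = a_1^2`, `c = a_2^1`, `d = a_2^2`. -/
inductive SURel (q : ℝ) :
    FreeAlgebra ℂ (Fin 2 × Fin 2) → FreeAlgebra ℂ (Fin 2 × Fin 2) → Prop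
  | ab : SURel q (suGen 0 0 * suGen 0 1) ((q : ℂ) • (suGen 0 1 * suGen 0 0))
  | ac : SURel q (suGen 0 0 * suGen 1 0) ((q : ℂ) • (suGen 1 0 * suGen 0 0))
  | bd : SURel q (suGen 0 1 * suGen 1 1) ((q : ℂ) • (suGen 1 1 * suGen 0 1))
  | cd : SURel q (suGen 1 0 * suGen 1 1) ((q : ℂ) • (suGen 1 1 * suGen 1 0))
  | bc : SURel q (suGen 0 1 * suGen 1 0) (suGen 1 0 * suGen 0 1)
  | ad : SURel q (suGen 0 0 * suGen 1 1 - suGen 1 1 * suGen 0 0)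
      (sig q • (suGen 0 1 * suGen 1 0))
  | det : SURel q (suGen 0 0 * suGen 1 1 - (q : ℂ) • (suGen 0 1 * suGen 1 0)) 1

/-- The coordinate algebra `H = A[SU_q(2)]`. As an algebra, `A[SU_q^cop(2)]` is the same; the two
differ in their coproducts `Δ(a_i^j) = a_i^μ ⊗ a_μ^j` and `Δ~(a_i^j) = a_μ^j ⊗ a_i^μ`. -/
def SUq (q : ℝ) : Type := RingQuot (SURel q)

instance (q : ℝ) : Ring (SUq q) := inferInstanceAs (Ring (RingQuot (SURel q)))
instance (q : ℝ) : Algebra ℂ (SUq q) := inferInstanceAs (Algebra ℂ (RingQuot (SURel q)))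

/-- The projection of the free algebra onto `A[SU_q(2)]`. -/
def suMk (q : ℝ) : FreeAlgebra ℂ (Fin 2 × Fin 2) →ₐ[ℂ] SUq q := RingQuot.mkAlgHom ℂ (SURel q)

/-- The entries `a_i^j` of the defining matrix `(a b; c d)` in `A[SU_q(2)]`. -/
def suMat (q : ℝ) (i j : Fin 2) : SUq q := suMk q (suGen i j)

/-- The matrix `S(a_i^j) = (a_j^i)^*`, that is `(d, -q⁻¹ b; -q c, a)`. -/
def suAntipode (q : ℝ) : Fin 2 → Fin 2 → SUq q :=
  ![![suMat q 1 1, (-(q : ℂ)⁻¹) • suMat q 0 1],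
    ![(-(q : ℂ)) • suMat q 1 0, suMat q 0 0]]

/-- The matrix `S⁻¹(a_i^j)`, that is `(d, -q b; -q⁻¹ c, a)`. This is the antipode of
`A[SU_q^cop(2)]`. -/
def suAntipodeInv (q : ℝ) : Fin 2 → Fin 2 → SUq q :=
  ![![suMat q 1 1, (-(q : ℂ)) • suMat q 0 1],
    ![(-(q : ℂ)⁻¹) • suMat q 1 0, suMat q 0 0]]

/-- The matrix `S(u_i^j)`, where `u = (a_2^2, -a_2^1; -a_1^2, a_1^1)`. -/
def suAntipodeU (q : ℝ) : Fin 2 → Fin 2 → SUq q :=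
  ![![suAntipode q 1 1, -suAntipode q 1 0],
    ![-suAntipode q 0 1, suAntipode q 0 0]]

/-! ### The classical subgroup `U(1)` -/

/-- The coordinate algebra `H' = A[U(1)] = ℂ[t, t⁻¹]`, with `t^* = t⁻¹`. -/
abbrev U1 : Type := LaurentPolynomial ℂ

/-- The values `a ↦ t`, `b ↦ 0`, `c ↦ 0`, `d ↦ t^*` on the free algebra. -/
def u1Free : FreeAlgebra ℂ (Fin 2 × Fin 2) →ₐ[ℂ] U1 :=
  FreeAlgebra.lift ℂ fun x =>
    if x.1 = x.2 then (if x.1 = 0 then LaurentPolynomial.T 1 else LaurentPolynomial.T (-1)) else 0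

theorem u1Free_rel (q : ℝ) ⦃x y : FreeAlgebra ℂ (Fin 2 × Fin 2)⦄ (h : SURel q x y) :
    u1Free x = u1Free y := by
  cases h <;> simp only [u1Free, suGen, map_mul, map_sub, map_smul, map_one,
    FreeAlgebra.lift_ι_apply, Fin.isValue, zero_ne_one, one_ne_zero, if_true, if_false, mul_zero,
    zero_mul, smul_zero, sub_zero, ← LaurentPolynomial.T_add]
  all_goals norm_num [LaurentPolynomial.T_zero]

/-- The projection `π : A[SU_q(2)] → A[U(1)]`. -/
def projU1 (q : ℝ) : SUq q →ₐ[ℂ] U1 :=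
  RingQuot.liftAlgHom ℂ ⟨u1Free, u1Free_rel q⟩

/-- The algebra `H~ ⊗ H` with `H~ = A[SU_q^cop(2)]`, `H = A[SU_q(2)]`. -/
abbrev HH (q : ℝ) : Type := SUq q ⊗[ℂ] SUq q

/-- The algebra `H' ⊗ H` with `H' = A[U(1)]`, `H = A[SU_q(2)]`. -/
abbrev UH (q : ℝ) : Type := U1 ⊗[ℂ] SUq q

/-- The projection `π ⊗ id : H~ ⊗ H → H' ⊗ H`. -/
def projUH (q : ℝ) : HH q →ₐ[ℂ] UH q :=
  Algebra.TensorProduct.map (projU1 q) (AlgHom.id ℂ (SUq q))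

/-! ### The quantum group `Sp_q(2)` and the coaction of `H~ ⊗ H` -/

/-- Index set of the `4 × 4` matrix `A = (a b; c d)` of `2 × 2` blocks: block, then position in the
block. The value `(0, i)` is the index `i`, and `(1, i)` is the index `i + 2`. -/
abbrev Idx4 : Type := Fin 2 × Fin 2

/-- The free algebra on the sixteen entries `A_i^j`. -/
abbrev SpFree : Type := FreeAlgebra ℂ (Idx4 × Idx4)

/-- The generator `A_i^j` of the free algebra. -/
def spA (i j : Idx4) : SpFree := FreeAlgebra.ι ℂ (i, j)

/-- The block `a`. -/
def ga (i j : Fin 2) : SpFree := spA (0, i) (0, j)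
/-- The block `b`. -/
def gb (i j : Fin 2) : SpFree := spA (0, i) (1, j)
/-- The block `c`. -/
def gc (i j : Fin 2) : SpFree := spA (1, i) (0, j)
/-- The block `d`. -/
def gd (i j : Fin 2) : SpFree := spA (1, i) (1, j)

/-- The adjoint `(A_i^j)^*`: every block has the form `(x_1, -q x_2^*; x_2, x_1^*)`. -/
def spAstar (q : ℝ) (i j : Idx4) : SpFree :=
  if i.2 = j.2 then spA (i.1, 1 - i.2) (j.1, 1 - j.2)
  else if i.2 = 0 then (-(q : ℂ)) • spA (i.1, 1) (j.1, 0)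
  else (-(q : ℂ)⁻¹) • spA (i.1, 0) (j.1, 1)

/-- `∑ R_k^α_i^β x_α^s y_β^t`. -/
def rowR (q : ℝ) (x y : Fin 2 → Fin 2 → SpFree) (k i s t : Fin 2) : SpFree :=
  ∑ α : Fin 2, ∑ β : Fin 2, Rmat q k α i β • (x α s * y β t)

/-- `∑ x_s^β y_t^α R_α^i_β^k`. -/
def colR (q : ℝ) (x y : Fin 2 → Fin 2 → SpFree) (s t i k : Fin 2) : SpFree :=
  ∑ α : Fin 2, ∑ β : Fin 2, Rmat q α i β k • (x s β * y t α)

/-- The relations of `Sp_q(2)`: those of the transformation bialgebra `M_q(2,ℍ)`, and the unitarity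
relations `(A_μ^j)^* A_μ^l = δ_j^l` and `A_j^μ (A_l^μ)^* = δ_j^l`. -/
inductive SpRel (q : ℝ) : SpFree → SpFree → Prop
  -- the relations inside each block
  | aa (i j k l : Fin 2) : SpRel q (rowR q ga ga i k j l) (colR q ga ga k i j l)
  | bb (i j k l : Fin 2) : SpRel q (rowR q gb gb i k j l) (colR q gb gb k i j l)
  | cc (i j k l : Fin 2) : SpRel q (rowR q gc gc i k j l) (colR q gc gc k i j l)
  | dd (i j k l : Fin 2) : SpRel q (rowR q gd gd i k j l) (colR q gd gd k i j l)
  -- `a` and `b`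
  | ba11 (i k : Fin 2) : SpRel q (gb i 0 * ga k 0) (zeta q • rowR q ga gb k i 0 0)
  | ba12 (i k : Fin 2) : SpRel q (gb i 0 * ga k 1) (zeta q • rowR q ga gb k i 1 0)
  | ab12 (i k : Fin 2) : SpRel q (ga i 0 * gb k 1) (zeta q • rowR q gb ga k i 1 0)
  | ab22 (i k : Fin 2) : SpRel q (ga i 1 * gb k 1) (zeta q • rowR q gb ga k i 1 1)
  -- `a` and `c`
  | ac11 (i k : Fin 2) : SpRel q (ga 0 i * gc 0 k) (zeta q • colR q gc ga 0 0 i k)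
  | ac12 (i k : Fin 2) : SpRel q (ga 0 i * gc 1 k) (zeta q • colR q gc ga 1 0 i k)
  | ca12 (i k : Fin 2) : SpRel q (gc 0 i * ga 1 k) (zeta q • colR q ga gc 1 0 i k)
  | ca22 (i k : Fin 2) : SpRel q (gc 1 i * ga 1 k) (zeta q • colR q ga gc 1 1 i k)
  -- `b` and `d`
  | bd11 (i k : Fin 2) : SpRel q (gb 0 i * gd 0 k) (zeta q • colR q gd gb 0 0 i k)
  | bd12 (i k : Fin 2) : SpRel q (gb 0 i * gd 1 k) (zeta q • colR q gd gb 1 0 i k)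
  | db12 (i k : Fin 2) : SpRel q (gd 0 i * gb 1 k) (zeta q • colR q gb gd 1 0 i k)
  | db22 (i k : Fin 2) : SpRel q (gd 1 i * gb 1 k) (zeta q • colR q gb gd 1 1 i k)
  -- `c` and `d`
  | dc11 (i k : Fin 2) : SpRel q (gd i 0 * gc k 0) (zeta q • rowR q gc gd k i 0 0)
  | dc12 (i k : Fin 2) : SpRel q (gd i 0 * gc k 1) (zeta q • rowR q gc gd k i 1 0)
  | cd12 (i k : Fin 2) : SpRel q (gc i 0 * gd k 1) (zeta q • rowR q gd gc k i 1 0)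
  | cd22 (i k : Fin 2) : SpRel q (gc i 1 * gd k 1) (zeta q • rowR q gd gc k i 1 1)
  -- `b` and `c`, `a` and `d`
  | cb1 (i j : Fin 2) : SpRel q (gc 0 j * gb i 0) ((zeta q) ^ 2 • (gb i 0 * gc 0 j))
  | cb2 (i j : Fin 2) : SpRel q (gc 1 j * gb i 1) (((zeta q) ^ 2)⁻¹ • (gb i 1 * gc 1 j))
  | da12 (i j : Fin 2) : SpRel q (gd 0 1 * ga i j) ((zeta q) ^ 2 • (ga i j * gd 0 1))
  | da21 (i j : Fin 2) : SpRel q (gd 1 0 * ga i j) (((zeta q) ^ 2)⁻¹ • (ga i j * gd 1 0))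
  | da11 (i j : Fin 2) : SpRel q (gd 0 0 * ga i j - ga i j * gd 0 0)
      ((zeta q * sig q) • (gb i 0 * gc 0 j))
  | ad22 (i j : Fin 2) : SpRel q (ga i j * gd 1 1 - gd 1 1 * ga i j)
      ((zeta q * sig q) • (gc 1 j * gb i 1))
  | cb12 (i j : Fin 2) : SpRel q (gc 0 j * gb i 1 - gb i 1 * gc 0 j)
      ((zeta q * sig q) • (ga i j * gd 0 1))
  | cb21 (i j : Fin 2) : SpRel q (gc 1 j * gb i 0 - gb i 0 * gc 1 j)
      ((zeta q * sig q) • (gd 1 0 * ga i j))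
  -- unitarity
  | starMul (j l : Idx4) :
      SpRel q (∑ μ : Idx4, spAstar q μ j * spA μ l) (if j = l then 1 else 0)
  | mulStar (j l : Idx4) :
      SpRel q (∑ μ : Idx4, spA j μ * spAstar q l μ) (if j = l then 1 else 0)

/-- The right coaction of `H~ ⊗ H` on words in the generators: on the first two rows,
`A_i^j ↦ A_μ^j ⊗ (a_i^μ ⊗ 1)`; on the last two rows, `A_i^j ↦ A_μ^j ⊗ (1 ⊗ S(u_i^μ))`, where `μ`
runs over the two rows in question; extended to products of generators as an algebra map. -/
def coactFree (q : ℝ) : SpFree →ₐ[ℂ] SpFree ⊗[ℂ] HH q :=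
  FreeAlgebra.lift ℂ fun x =>
    ∑ μ : Fin 2, spA (x.1.1, μ) x.2 ⊗ₜ[ℂ]
      (if x.1.1 = 0 then suMat q x.1.2 μ ⊗ₜ[ℂ] (1 : SUq q)
        else (1 : SUq q) ⊗ₜ[ℂ] suAntipodeU q x.1.2 μ)

/-- A family `r` of relations between words in the generators is compatible with the coaction if the
coaction descends to the algebra presented by `r`. -/
def IsCovariant (q : ℝ) (r : SpFree → SpFree → Prop) : Prop :=
  ∀ x y, r x y →
    Algebra.TensorProduct.map (RingQuot.mkAlgHom ℂ r) (AlgHom.id ℂ (HH q)) (coactFree q x) =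
      Algebra.TensorProduct.map (RingQuot.mkAlgHom ℂ r) (AlgHom.id ℂ (HH q)) (coactFree q y)

/-- The largest family of relations that follow from those of `Sp_q(2)` and that is compatible with
the coaction: the union of all compatible families of consequences of `SpRel`. If `SpRel` itself is
compatible, this is the family of all consequences of `SpRel`. -/
def SpCovRel (q : ℝ) (x y : SpFree) : Prop :=
  ∃ r : SpFree → SpFree → Prop, IsCovariant q r ∧
    (∀ x y, r x y → RingQuot.mkAlgHom ℂ (SpRel q) x = RingQuot.mkAlgHom ℂ (SpRel q) y) ∧ r x y

/-- The total space `P = A[Sp_q(2)]` of the bundle, as a right `H~ ⊗ H`-comodule algebra. -/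
def Spq (q : ℝ) : Type := RingQuot (SpCovRel q)

instance (q : ℝ) : Ring (Spq q) := inferInstanceAs (Ring (RingQuot (SpCovRel q)))
instance (q : ℝ) : Algebra ℂ (Spq q) := inferInstanceAs (Algebra ℂ (RingQuot (SpCovRel q)))

/-- The projection of the free algebra onto `A[Sp_q(2)]`. -/
def spMk (q : ℝ) : SpFree →ₐ[ℂ] Spq q := RingQuot.mkAlgHom ℂ (SpCovRel q)

/-- If the relations of `Sp_q(2)` are compatible with the coaction, then two words agree in `P` if and
only if they agree in the algebra presented by these relations. -/
theorem spMk_eq_iff (q : ℝ) (h : IsCovariant q (SpRel q)) (x y : SpFree) :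
    spMk q x = spMk q y ↔
      RingQuot.mkAlgHom ℂ (SpRel q) x = RingQuot.mkAlgHom ℂ (SpRel q) y := by
  let f : Spq q →ₐ[ℂ] RingQuot (SpRel q) := RingQuot.liftAlgHom ℂ
    ⟨RingQuot.mkAlgHom ℂ (SpRel q), fun a b hab => by
      obtain ⟨r, _, hr, hab⟩ := hab
      exact hr a b hab⟩
  let g : RingQuot (SpRel q) →ₐ[ℂ] Spq q := RingQuot.liftAlgHom ℂ
    ⟨spMk q, fun a b hab => RingQuot.mkAlgHom_rel ℂ
      ⟨SpRel q, h, fun _ _ h' => RingQuot.mkAlgHom_rel ℂ h', hab⟩⟩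
  have hf : ∀ x, f (spMk q x) = RingQuot.mkAlgHom ℂ (SpRel q) x :=
    fun x => RingQuot.liftAlgHom_mkAlgHom_apply ℂ _ _ _
  have hg : ∀ x, g (RingQuot.mkAlgHom ℂ (SpRel q) x) = spMk q x :=
    fun x => RingQuot.liftAlgHom_mkAlgHom_apply ℂ _ _ _
  constructor
  · intro e; rw [← hf, ← hf, e]
  · intro e; rw [← hg, ← hg, e]

theorem coact_rel (q : ℝ) ⦃x y : SpFree⦄ (h : SpCovRel q x y) :
    ((Algebra.TensorProduct.map (spMk q) (AlgHom.id ℂ (HH q))).comp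
      (coactFree q)) x =
    ((Algebra.TensorProduct.map (spMk q) (AlgHom.id ℂ (HH q))).comp
      (coactFree q)) y := by
  obtain ⟨r, hr, hr', hxy⟩ := h
  let f : RingQuot r →ₐ[ℂ] Spq q := RingQuot.liftAlgHom ℂ
    ⟨spMk q, fun a b hab =>
      RingQuot.mkAlgHom_rel ℂ ⟨r, hr, hr', hab⟩⟩
  have hf : f.comp (RingQuot.mkAlgHom ℂ r) = spMk q := by
    ext a
    exact RingQuot.liftAlgHom_mkAlgHom_apply ℂ _ _ _
  have key : Algebra.TensorProduct.map (spMk q) (AlgHom.id ℂ (HH q)) =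
      (Algebra.TensorProduct.map f (AlgHom.id ℂ (HH q))).comp
        (Algebra.TensorProduct.map (RingQuot.mkAlgHom ℂ r) (AlgHom.id ℂ (HH q))) := by
    rw [← Algebra.TensorProduct.map_comp, hf, AlgHom.comp_id]
  simp only [AlgHom.comp_apply, key]
  rw [hr x y hxy]

/-- The coaction `P → P ⊗ (H~ ⊗ H)`. -/
def coactSp (q : ℝ) : Spq q →ₐ[ℂ] Spq q ⊗[ℂ] HH q :=
  RingQuot.liftAlgHom ℂ
    ⟨(Algebra.TensorProduct.map (spMk q) (AlgHom.id ℂ (HH q))).comp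
      (coactFree q), coact_rel q⟩

/-- The induced coaction `P → P ⊗ (H' ⊗ H)`. -/
def coactSpU (q : ℝ) : Spq q →ₐ[ℂ] Spq q ⊗[ℂ] UH q :=
  (Algebra.TensorProduct.map (AlgHom.id ℂ (Spq q)) (projUH q)).comp (coactSp q)

/-! ### Comodules -/

section Comodules

variable {K : Type*} [Semiring K] [Algebra ℂ K]

/-- The coaction `e_j ↦ ∑ e_i ⊗ T_i^j` on `ℂ^ι` given by a matrix `T` over `K`. -/
def matrixCoact {ι : Type} [Fintype ι] [DecidableEq ι] (T : ι → ι → K) :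
    (ι → ℂ) →ₗ[ℂ] (ι → ℂ) ⊗[ℂ] K :=
  (Pi.basisFun ℂ ι).constr ℂ fun j => ∑ i, Pi.basisFun ℂ ι i ⊗ₜ[ℂ] T i j

/-- The right tensor product coaction `m ⊗ n ↦ m₀ ⊗ n₀ ⊗ m₁ n₁`. -/
def tensorCoact {M N : Type*} [AddCommMonoid M] [Module ℂ M] [AddCommMonoid N] [Module ℂ N]
    (δM : M →ₗ[ℂ] M ⊗[ℂ] K) (δN : N →ₗ[ℂ] N ⊗[ℂ] K) : M ⊗[ℂ] N →ₗ[ℂ] (M ⊗[ℂ] N) ⊗[ℂ] K :=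
  LinearMap.lTensor (M ⊗[ℂ] N) (LinearMap.mul' ℂ K) ∘ₗ
    (TensorProduct.tensorTensorTensorComm ℂ M K N K).toLinearMap ∘ₗ TensorProduct.map δM δN

/-- The coinvariant elements `{m : δ(m) = m ⊗ 1}`. -/
def coinv {M : Type*} [AddCommMonoid M] [Module ℂ M] (δ : M →ₗ[ℂ] M ⊗[ℂ] K) : Submodule ℂ M :=
  LinearMap.eqLocus δ ((TensorProduct.mk ℂ M K).flip 1)

end Comodules

/-- The eigenspace `{v : f(v) = c v}`. -/
def eigen {V : Type*} [AddCommMonoid V] [Module ℂ V] (f : V →ₗ[ℂ] V) (c : ℂ) : Submodule ℂ V :=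
  LinearMap.eqLocus f (c • LinearMap.id)

/-- For a subspace `U` of `V`, the subspace `P ⊗ U` of `P ⊗ V`. -/
def tensorSub (P : Type*) [AddCommMonoid P] [Module ℂ P] {V : Type*} [AddCommMonoid V] [Module ℂ V]
    (U : Submodule ℂ V) : Submodule ℂ (P ⊗[ℂ] V) :=
  LinearMap.range (LinearMap.lTensor P U.subtype)

/-! ### The comodules `V~_{1/2}`, `V_{1/2}`, and the braiding on `W = V~_{1/2} ⊗ V_{1/2}` -/

/-- The underlying space `ℂ²` of `V_{1/2}` (basis `x, y`) and of `V~_{1/2}` (basis `x~, y~`). -/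
abbrev C2 : Type := Fin 2 → ℂ

/-- The basis `x, y` of `V_{1/2}`, respectively `x~, y~` of `V~_{1/2}`. -/
def e2 (i : Fin 2) : C2 := Pi.basisFun ℂ (Fin 2) i

/-- `V_{1/2}` as a right `H~ ⊗ H`-comodule, `x_j ↦ x_i ⊗ (1 ⊗ a_i^j)`. -/
def coactV (q : ℝ) : C2 →ₗ[ℂ] C2 ⊗[ℂ] HH q :=
  matrixCoact fun i j => (1 : SUq q) ⊗ₜ[ℂ] suMat q i j

/-- `V~_{1/2}` as a right `H~ ⊗ H`-comodule, `x~_j ↦ x~_i ⊗ (S~(a_i^j) ⊗ 1)`. -/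
def coactVt (q : ℝ) : C2 →ₗ[ℂ] C2 ⊗[ℂ] HH q :=
  matrixCoact fun i j => suAntipodeInv q i j ⊗ₜ[ℂ] (1 : SUq q)

/-- The space `W = V~_{1/2} ⊗ V_{1/2}`. -/
abbrev W : Type := C2 ⊗[ℂ] C2

/-- The right `H~ ⊗ H`-coaction on `W`. -/
def coactW (q : ℝ) : W →ₗ[ℂ] W ⊗[ℂ] HH q := tensorCoact (coactVt q) (coactV q)

/-- The braiding `Ψ` on `V_{1/2} ⊗ V_{1/2}`. -/
def braid (q : ℝ) : C2 ⊗[ℂ] C2 →ₗ[ℂ] C2 ⊗[ℂ] C2 :=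
  ((Pi.basisFun ℂ (Fin 2)).tensorProduct (Pi.basisFun ℂ (Fin 2))).constr ℂ fun
    | (0, 0) => sqrtq q • (e2 0 ⊗ₜ[ℂ] e2 0)
    | (0, 1) => zeta q • (e2 1 ⊗ₜ[ℂ] e2 0 + sig q • (e2 0 ⊗ₜ[ℂ] e2 1))
    | (1, 0) => zeta q • (e2 0 ⊗ₜ[ℂ] e2 1)
    | (1, 1) => sqrtq q • (e2 1 ⊗ₜ[ℂ] e2 1)

/-- The braiding `Ψ~` on `V~_{1/2} ⊗ V~_{1/2}`: for the opposite coproduct, the coquasitriangular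
structure is the one of `A[SU_q(2)]` with its two arguments exchanged, so that
`Ψ~(x~_j ⊗ x~_l) = ζ ∑ R_k^l_i^j x~_k ⊗ x~_i`. -/
def braidt (q : ℝ) : C2 ⊗[ℂ] C2 →ₗ[ℂ] C2 ⊗[ℂ] C2 :=
  ((Pi.basisFun ℂ (Fin 2)).tensorProduct (Pi.basisFun ℂ (Fin 2))).constr ℂ fun
    | (0, 0) => sqrtq q • (e2 0 ⊗ₜ[ℂ] e2 0)
    | (0, 1) => zeta q • (e2 1 ⊗ₜ[ℂ] e2 0)
    | (1, 0) => zeta q • (e2 0 ⊗ₜ[ℂ] e2 1 + sig q • (e2 1 ⊗ₜ[ℂ] e2 0))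
    | (1, 1) => sqrtq q • (e2 1 ⊗ₜ[ℂ] e2 1)

/-- The exchange of the two inner tensor factors. -/
def midFlip : W ⊗[ℂ] W ≃ₗ[ℂ] (C2 ⊗[ℂ] C2) ⊗[ℂ] (C2 ⊗[ℂ] C2) :=
  TensorProduct.tensorTensorTensorComm ℂ C2 C2 C2 C2

/-- The braiding `Φ` on `W ⊗ W`. -/
def braidW (q : ℝ) : Module.End ℂ (W ⊗[ℂ] W) :=
  midFlip.symm.toLinearMap ∘ₗ TensorProduct.map (braidt q) (braid q) ∘ₗ midFlip.toLinearMap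

/-- The space `V^{∧2}` of `q`-antisymmetric tensors: the eigenspace of `Φ` for `-q⁻¹`. -/
def asymW (q : ℝ) : Submodule ℂ (W ⊗[ℂ] W) := eigen (braidW q) (-(q : ℂ)⁻¹)

/-- The trivial subcomodule `V~_0` of `V~_{1/2} ⊗ V~_{1/2}`: the eigenspace of `Ψ~` for
`-q^{-3/2}`. -/
def spin0t (q : ℝ) : Submodule ℂ (C2 ⊗[ℂ] C2) :=
  eigen (braidt q) (-(zeta q) ^ 3)

/-- The spin one subcomodule `V_1` of `V_{1/2} ⊗ V_{1/2}`: the three-dimensional eigenspace of `Ψ`,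
for `q^{1/2}`. -/
def spin1 (q : ℝ) : Submodule ℂ (C2 ⊗[ℂ] C2) := eigen (braid q) (sqrtq q)

/-- The subcomodule `V~_0 ⊗ V_1` of `W ⊗ W`. -/
def asdW (q : ℝ) : Submodule ℂ (W ⊗[ℂ] W) :=
  Submodule.map midFlip.symm.toLinearMap
    (LinearMap.range (TensorProduct.map (spin0t q).subtype (spin1 q).subtype))

/-! ### Two-forms on `S^4_q` -/

/-- The `H~ ⊗ H`-coinvariant elements of `P ⊗ W ⊗ W`. -/
def coinvS4 (q : ℝ) : Submodule ℂ (Spq q ⊗[ℂ] (W ⊗[ℂ] W)) :=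
  coinv (tensorCoact (coactSp q).toLinearMap (tensorCoact (coactW q) (coactW q)))

/-- The two-forms `Ω²S^4_q = (P ⊗ V^{∧2})^{H~ ⊗ H}`. -/
def twoFormsS4 (q : ℝ) : Submodule ℂ (Spq q ⊗[ℂ] (W ⊗[ℂ] W)) :=
  coinvS4 q ⊓ tensorSub (Spq q) (asymW q)

/-- The anti-self-dual two-forms `Ω²₋S^4_q = (P ⊗ (V~_0 ⊗ V_1))^{H~ ⊗ H}`. -/
def asdFormsS4 (q : ℝ) : Submodule ℂ (Spq q ⊗[ℂ] (W ⊗[ℂ] W)) :=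
  coinvS4 q ⊓ tensorSub (Spq q) (asdW q)

/-! ### Two-forms on twistor space `CP^3_q` -/

/-- Index set of a basis of `V^ = (U_2 ⊗ V_0) ⊕ (U_1 ⊗ V_{1/2}) ⊕ (U_0 ⊗ V_0) ⊕ (U_{-1} ⊗ V_{1/2})
⊕ (U_{-2} ⊗ V_0)`: the values `inl 0, inl 1, inl 2` stand for `U_2, U_0, U_{-2}`, and `inr (0, i)`,
`inr (1, i)` for the basis of `U_1 ⊗ V_{1/2}`, `U_{-1} ⊗ V_{1/2}`. -/
abbrev TwIdx : Type := Fin 3 ⊕ Fin 2 × Fin 2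

/-- The comodule `V^`. -/
abbrev Vh : Type := TwIdx → ℂ

/-- The basis of `V^`. -/
def eh (n : TwIdx) : Vh := Pi.basisFun ℂ TwIdx n

/-- The weights `2, 0, -2` of the one-dimensional summands. -/
def wt1 : Fin 3 → ℤ := ![2, 0, -2]

/-- The weights `1, -1` of the two-dimensional summands. -/
def wt2 : Fin 2 → ℤ := ![1, -1]

/-- The `U(1)`-weight of a basis vector. -/
def wt : TwIdx → ℤ
  | Sum.inl k => wt1 k
  | Sum.inr (k, _) => wt2 k

/-- The right `H' ⊗ H`-coaction on `V^`. -/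
def coactVh (q : ℝ) : Vh →ₗ[ℂ] Vh ⊗[ℂ] UH q :=
  matrixCoact fun
    | Sum.inl k, Sum.inl l =>
        if k = l then (LaurentPolynomial.T (wt1 k) : U1) ⊗ₜ[ℂ] (1 : SUq q) else 0
    | Sum.inr (k, i), Sum.inr (l, j) =>
        if k = l then (LaurentPolynomial.T (wt2 k) : U1) ⊗ₜ[ℂ] suMat q i j else 0
    | _, _ => 0

/-- The inclusions `V_{1/2} ≅ U_{±1} ⊗ V_{1/2} → V^`. -/
def inclV (k : Fin 2) : C2 →ₗ[ℂ] Vh :=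
  (Pi.basisFun ℂ (Fin 2)).constr ℂ fun i => eh (Sum.inr (k, i))

/-- The braiding `Φ^` on `V^ ⊗ V^`: the flip on the `U(1)`-part, combined with `Ψ` on
`V_{1/2} ⊗ V_{1/2}`, and with the flip where a factor `V_0` occurs. -/
def braidVh (q : ℝ) : Module.End ℂ (Vh ⊗[ℂ] Vh) :=
  ((Pi.basisFun ℂ TwIdx).tensorProduct (Pi.basisFun ℂ TwIdx)).constr ℂ fun
    | (Sum.inr (k, i), Sum.inr (l, j)) =>
        TensorProduct.map (inclV l) (inclV k) (braid q (e2 i ⊗ₜ[ℂ] e2 j))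
    | (m, n) => eh n ⊗ₜ[ℂ] eh m

/-- The six eigenvalues `1, q^{1/2}, q^{-3/2}` and `-1, -q^{1/2}, -q^{-3/2}` of `Φ^`. -/
def eigs (q : ℝ) : Fin 6 → ℂ :=
  ![1, sqrtq q, (zeta q) ^ 3, -1, -sqrtq q, -(zeta q) ^ 3]

/-- The 21-dimensional space `V^^{∧2}` of `q`-antisymmetric tensors: the sum of the eigenspaces of
`Φ^` for the negative eigenvalues. -/
def asymVh (q : ℝ) : Submodule ℂ (Vh ⊗[ℂ] Vh) :=
  eigen (braidVh q) (-1) ⊔ eigen (braidVh q) (-sqrtq q) ⊔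
    eigen (braidVh q) (-(zeta q) ^ 3)

/-- The projection of a tensor in `V^ ⊗ V^` to its `q`-antisymmetric part, that is the spectral
projection of `Φ^` which is `1` on the eigenspaces for the negative eigenvalues and `0` on those for
the positive ones; written as an interpolation polynomial in `Φ^`. -/
def asymPart (q : ℝ) : Module.End ℂ (Vh ⊗[ℂ] Vh) :=
  Polynomial.aeval (braidVh q)
    (Lagrange.interpolate Finset.univ (eigs q) ![0, 0, 0, 1, 1, 1])

/-- The product `v ∧_q w` of elements of `V^`, as an element of `V^^{∧2}`. -/
def wedgeVh (q : ℝ) (v w : Vh) : Vh ⊗[ℂ] Vh := asymPart q (v ⊗ₜ[ℂ] w)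

/-- The summands `T_+`, `T_0`, `T_-` of `V^`: the parts of positive, zero, negative weight. -/
def Tpart (s : SignType) : Submodule ℂ Vh :=
  Submodule.span ℂ {v | ∃ n : TwIdx, SignType.sign (wt n) = s ∧ v = eh n}

/-- The elements of `V^^{∧2}` of type `(m,a,n)`: sums of products of `m` elements of `T_+`, `a`
elements of `T_0` and `n` elements of `T_-`, in any order. -/
def typeVh (q : ℝ) (m a n : ℕ) : Submodule ℂ (Vh ⊗[ℂ] Vh) :=
  Submodule.span ℂ {x | ∃ s t : SignType,
    ({s, t} : Multiset SignType) =
      Multiset.replicate m 1 + Multiset.replicate a 0 + Multiset.replicate n (-1) ∧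
    ∃ v ∈ Tpart s, ∃ w ∈ Tpart t, x = wedgeVh q v w}

/-- The `H' ⊗ H`-coinvariant elements of `P ⊗ V^ ⊗ V^`. -/
def coinvCP3 (q : ℝ) : Submodule ℂ (Spq q ⊗[ℂ] (Vh ⊗[ℂ] Vh)) :=
  coinv (tensorCoact (coactSpU q).toLinearMap (tensorCoact (coactVh q) (coactVh q)))

/-- The two-forms `Ω²CP^3_q = (P ⊗ V^^{∧2})^{H' ⊗ H}`. -/
def twoFormsCP3 (q : ℝ) : Submodule ℂ (Spq q ⊗[ℂ] (Vh ⊗[ℂ] Vh)) :=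
  coinvCP3 q ⊓ tensorSub (Spq q) (asymVh q)

/-- The two-forms on `CP^3_q` of type `(m,a,n)`. -/
def typeFormsCP3 (q : ℝ) (m a n : ℕ) : Submodule ℂ (Spq q ⊗[ℂ] (Vh ⊗[ℂ] Vh)) :=
  twoFormsCP3 q ⊓ tensorSub (Spq q) (typeVh q m a n)

/-! ### The push-out map -/

/-- The map `j : V = V~_{1/2} ⊗ V_{1/2} → V^` given by `V~_{1/2} ≅ U_1 ⊕ U_{-1}`, where `x~` has
weight `-1` and `y~` has weight `1`. -/
def jmap : W →ₗ[ℂ] Vh :=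
  ((Pi.basisFun ℂ (Fin 2)).tensorProduct (Pi.basisFun ℂ (Fin 2))).constr ℂ fun p =>
    eh (Sum.inr (1 - p.1, p.2))

/-- The map `j_* : V ⊗ V ⊇ V^{∧2} → V^^{∧2}`, `v ∧_q w ↦ j(v) ∧_q j(w)`. -/
def jmap2 (q : ℝ) : W ⊗[ℂ] W →ₗ[ℂ] Vh ⊗[ℂ] Vh := asymPart q ∘ₗ TensorProduct.map jmap jmap

/-- The push-out map `η_* = id ⊗ j_*` on two-forms. -/
def pushOut (q : ℝ) : Spq q ⊗[ℂ] (W ⊗[ℂ] W) →ₗ[ℂ] Spq q ⊗[ℂ] (Vh ⊗[ℂ] Vh) :=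
  LinearMap.lTensor (Spq q) (jmap2 q)

end QTwistor

end

/-! The eigenvalue -q⁻¹ of Φ arises as (-q^{-3/2})·q^{1/2} and as q^{1/2}·(-q^{-3/2}), so V^{∧2} is
the sum of V~_0 ⊗ V_1 and V~_1 ⊗ V_0. A two-form is anti-self-dual when its component in V~_1 ⊗ V_0
vanishes, and the question is how the push-out sees that component.

That η_* maps two-forms to two-forms is naturality. The projection to V^^{∧2} is a polynomial in the
braiding Φ^, hence covariant (`asymPart_covariant`), and j intertwines the coactions along π ⊗ id
(`jmap_covariant`). The image consists of sums of eigenvectors because Φ^ is annihilated by the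
product of the X - λ over its six eigenvalues (`asymPart_mem_asymVh`).

The line V~_0 is spanned by x~ ⊗ y~ - q⁻¹ y~ ⊗ x~. Each of its terms pairs weights of opposite sign,
so anti-self-dual forms are pushed out to type (1,0,1) (`asdW_le_comap_typeVh`).

Conversely, three functionals detect V~_1 ⊗ V_0, one for each weight of V~_1. The two of extremal
weight factor through the push-out and vanish on type (1,0,1), since they only see U_k paired with
itself (`lTensor_funW_eq_zero`). The one of weight zero cannot be controlled in this way: x~ ⊗ y~
and y~ ⊗ x~ have type (1,0,1) themselves. Here coinvariance under all of H~ is needed, not only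
under its quotient H'. The three values on a coinvariant element transform together under an
irreducible spin one comodule, so the middle one cannot be the only one that is non-zero. A
triangular 2 × 2 representation of H~ in which b acts non-trivially suffices to see this
(`lTensor_funW_two_eq_zero`). Once all three values vanish, `mem_asdW` and the flatness of P over ℂ
give the conclusion. -/

namespace QTwistor

/-! ### Scalars -/

section Scalars
variable {q : ℝ}

theorem sqrtq_sq (hq : 0 < q) : sqrtq q ^ 2 = (q : ℂ) := by
  rw [sqrtq, ← Complex.ofReal_pow, Real.sq_sqrt hq.le]

theorem sqrtq_ne_zero (hq : 0 < q) : sqrtq q ≠ 0 := by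
  rw [sqrtq, Complex.ofReal_ne_zero]
  exact (Real.sqrt_pos.2 hq).ne'

theorem eigs_eq_ofReal (q : ℝ) : eigs q =
    fun i => ((![1, √q, (√q)⁻¹ ^ 3, -1, -√q, -(√q)⁻¹ ^ 3] i : ℝ) : ℂ) := by
  funext i
  fin_cases i <;> simp [eigs, zeta, sqrtq]

/-- The only place where q < 1 enters: 0 < √q < 1 < ζ³ keeps the six interpolation nodes apart. -/
theorem eigs_injective (hq0 : 0 < q) (hq1 : q < 1) : Function.Injective (eigs q) := by
  have h0 : 0 < √q := Real.sqrt_pos.2 hq0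
  have h1 : √q < 1 := by rw [Real.sqrt_lt' one_pos]; simpa using hq1
  have h2 : 1 < (√q)⁻¹ ^ 3 := one_lt_pow₀ ((one_lt_inv₀ h0).2 h1) three_ne_zero
  rw [eigs_eq_ofReal]
  refine Complex.ofReal_injective.comp ?_
  generalize (√q)⁻¹ ^ 3 = z at *
  intro i j
  fin_cases i <;> fin_cases j <;> simp <;> intro h <;> linarith

end Scalars

/-! ### The braidings on basis tensors -/

theorem basisFun_eq_e2 (i : Fin 2) : Pi.basisFun ℂ (Fin 2) i = e2 i := rfl

section Braid
variable (q : ℝ)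

theorem braid_e2 (i j : Fin 2) : braid q (e2 i ⊗ₜ e2 j) = match i, j with
    | 0, 0 => sqrtq q • (e2 0 ⊗ₜ[ℂ] e2 0)
    | 0, 1 => zeta q • (e2 1 ⊗ₜ[ℂ] e2 0 + sig q • (e2 0 ⊗ₜ[ℂ] e2 1))
    | 1, 0 => zeta q • (e2 0 ⊗ₜ[ℂ] e2 1)
    | 1, 1 => sqrtq q • (e2 1 ⊗ₜ[ℂ] e2 1) := by
  have := ((Pi.basisFun ℂ (Fin 2)).tensorProduct (Pi.basisFun ℂ (Fin 2))).constr_basis ℂ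
    (fun
    | (0, 0) => sqrtq q • (e2 0 ⊗ₜ[ℂ] e2 0)
    | (0, 1) => zeta q • (e2 1 ⊗ₜ[ℂ] e2 0 + sig q • (e2 0 ⊗ₜ[ℂ] e2 1))
    | (1, 0) => zeta q • (e2 0 ⊗ₜ[ℂ] e2 1)
    | (1, 1) => sqrtq q • (e2 1 ⊗ₜ[ℂ] e2 1)) (i, j)
  rw [Module.Basis.tensorProduct_apply] at this
  fin_cases i <;> fin_cases j <;> exact this

theorem braidt_e2 (i j : Fin 2) : braidt q (e2 i ⊗ₜ e2 j) = match i, j with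
    | 0, 0 => sqrtq q • (e2 0 ⊗ₜ[ℂ] e2 0)
    | 0, 1 => zeta q • (e2 1 ⊗ₜ[ℂ] e2 0)
    | 1, 0 => zeta q • (e2 0 ⊗ₜ[ℂ] e2 1 + sig q • (e2 1 ⊗ₜ[ℂ] e2 0))
    | 1, 1 => sqrtq q • (e2 1 ⊗ₜ[ℂ] e2 1) := by
  have := ((Pi.basisFun ℂ (Fin 2)).tensorProduct (Pi.basisFun ℂ (Fin 2))).constr_basis ℂ
    (fun
    | (0, 0) => sqrtq q • (e2 0 ⊗ₜ[ℂ] e2 0)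
    | (0, 1) => zeta q • (e2 1 ⊗ₜ[ℂ] e2 0)
    | (1, 0) => zeta q • (e2 0 ⊗ₜ[ℂ] e2 1 + sig q • (e2 1 ⊗ₜ[ℂ] e2 0))
    | (1, 1) => sqrtq q • (e2 1 ⊗ₜ[ℂ] e2 1)) (i, j)
  rw [Module.Basis.tensorProduct_apply] at this
  fin_cases i <;> fin_cases j <;> exact this

theorem jmap_e2 (i j : Fin 2) : jmap (e2 i ⊗ₜ e2 j) = eh (Sum.inr (1 - i, j)) := by
  have := ((Pi.basisFun ℂ (Fin 2)).tensorProduct (Pi.basisFun ℂ (Fin 2))).constr_basis ℂ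
    (fun p => eh (Sum.inr (1 - p.1, p.2))) (i, j)
  rwa [Module.Basis.tensorProduct_apply] at this

theorem inclV_e2 (k i : Fin 2) : inclV k (e2 i) = eh (Sum.inr (k, i)) :=
  (Pi.basisFun ℂ (Fin 2)).constr_basis ℂ (fun i => eh (Sum.inr (k, i))) i

/-- The weight labels k and l are exchanged, so in general only even powers of Φ^ preserve a given
copy of V_{1/2} ⊗ V_{1/2}. This is why the polynomial identity for Ψ below is one in Ψ². -/
theorem braidVh_inr (k l : Fin 2) (x : C2 ⊗[ℂ] C2) :
    braidVh q (TensorProduct.map (inclV k) (inclV l) x) =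
      TensorProduct.map (inclV l) (inclV k) (braid q x) := by
  suffices braidVh q ∘ₗ TensorProduct.map (inclV k) (inclV l) =
      TensorProduct.map (inclV l) (inclV k) ∘ₗ braid q from LinearMap.congr_fun this x
  refine ((Pi.basisFun ℂ (Fin 2)).tensorProduct (Pi.basisFun ℂ (Fin 2))).ext fun p => ?_
  rw [Module.Basis.tensorProduct_apply, basisFun_eq_e2, basisFun_eq_e2, LinearMap.comp_apply,
    TensorProduct.map_tmul, inclV_e2, inclV_e2]
  have := ((Pi.basisFun ℂ TwIdx).tensorProduct (Pi.basisFun ℂ TwIdx)).constr_basis ℂ (fun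
    | (Sum.inr (k, i), Sum.inr (l, j)) =>
        TensorProduct.map (inclV l) (inclV k) (braid q (e2 i ⊗ₜ[ℂ] e2 j))
    | (m, n) => eh n ⊗ₜ[ℂ] eh m) (Sum.inr (k, p.1), Sum.inr (l, p.2))
  rw [Module.Basis.tensorProduct_apply] at this
  exact this

theorem braidVh_inl_left (k : Fin 3) (n : TwIdx) :
    braidVh q (eh (Sum.inl k) ⊗ₜ eh n) = eh n ⊗ₜ eh (Sum.inl k) := by
  have := ((Pi.basisFun ℂ TwIdx).tensorProduct (Pi.basisFun ℂ TwIdx)).constr_basis ℂ (fun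
    | (Sum.inr (k, i), Sum.inr (l, j)) =>
        TensorProduct.map (inclV l) (inclV k) (braid q (e2 i ⊗ₜ[ℂ] e2 j))
    | (m, n) => eh n ⊗ₜ[ℂ] eh m) (Sum.inl k, n)
  rw [Module.Basis.tensorProduct_apply] at this
  exact this

theorem braidVh_inl_right (n : TwIdx) (k : Fin 3) :
    braidVh q (eh n ⊗ₜ eh (Sum.inl k)) = eh (Sum.inl k) ⊗ₜ eh n := by
  have := ((Pi.basisFun ℂ TwIdx).tensorProduct (Pi.basisFun ℂ TwIdx)).constr_basis ℂ (fun
    | (Sum.inr (k, i), Sum.inr (l, j)) =>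
        TensorProduct.map (inclV l) (inclV k) (braid q (e2 i ⊗ₜ[ℂ] e2 j))
    | (m, n) => eh n ⊗ₜ[ℂ] eh m) (n, Sum.inl k)
  rw [Module.Basis.tensorProduct_apply] at this
  rcases n with n | n <;> exact this

/-- Linear maps on `V^ ⊗ V^` agree if they agree on basis tensors with a factor in `V_0` and on the
four copies of `V_{1/2} ⊗ V_{1/2}`. -/
theorem Vh_tensor_ext {N : Type*} [AddCommMonoid N] [Module ℂ N] {f g : Vh ⊗[ℂ] Vh →ₗ[ℂ] N}
    (hl : ∀ k n, f (eh (Sum.inl k) ⊗ₜ eh n) = g (eh (Sum.inl k) ⊗ₜ eh n))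
    (hr : ∀ n k, f (eh n ⊗ₜ eh (Sum.inl k)) = g (eh n ⊗ₜ eh (Sum.inl k)))
    (h : ∀ k l x, f (TensorProduct.map (inclV k) (inclV l) x) =
      g (TensorProduct.map (inclV k) (inclV l) x)) : f = g := by
  refine ((Pi.basisFun ℂ TwIdx).tensorProduct (Pi.basisFun ℂ TwIdx)).ext fun p => ?_
  rw [Module.Basis.tensorProduct_apply]
  change f (eh p.1 ⊗ₜ eh p.2) = g (eh p.1 ⊗ₜ eh p.2)
  rcases p with ⟨m | ⟨k, i⟩, n | ⟨l, j⟩⟩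
  · exact hl _ _
  · exact hl _ _
  · exact hr _ _
  · simpa only [TensorProduct.map_tmul, inclV_e2] using h k l (e2 i ⊗ₜ e2 j)

variable {q}

/-- `(Ψ² - q)(Ψ² - ζ⁶) = 0`. -/
theorem braid_sq_sq (hq : 0 < q) (x : C2 ⊗[ℂ] C2) :
    braid q (braid q (braid q (braid q x))) =
      ((q : ℂ) + zeta q ^ 6) • braid q (braid q x) - ((q : ℂ) * zeta q ^ 6) • x := by
  suffices braid q ∘ₗ braid q ∘ₗ braid q ∘ₗ braid q =
      ((q : ℂ) + zeta q ^ 6) • (braid q ∘ₗ braid q) - ((q : ℂ) * zeta q ^ 6) • LinearMap.id from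
    LinearMap.congr_fun this x
  have h0 := sqrtq_ne_zero hq
  refine ((Pi.basisFun ℂ (Fin 2)).tensorProduct (Pi.basisFun ℂ (Fin 2))).ext fun p => ?_
  rw [Module.Basis.tensorProduct_apply, basisFun_eq_e2, basisFun_eq_e2]
  rcases p with ⟨i, j⟩
  simp only [LinearMap.comp_apply, LinearMap.sub_apply, LinearMap.smul_apply, LinearMap.id_apply]
  fin_cases i <;> fin_cases j <;>
    simp only [Fin.zero_eta, Fin.mk_one, braid_e2, map_smul, map_add, smul_smul, smul_add] <;>
    match_scalars <;> simp only [zeta, sig, ← sqrtq_sq hq] <;> field_simp <;> ring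

/-! ### The spectral projection of Φ^ -/

theorem nodal_eigs (hq : 0 < q) : Lagrange.nodal Finset.univ (eigs q) =
    (Polynomial.X ^ 2 - 1) * (Polynomial.X ^ 4 - Polynomial.C ((q : ℂ) + zeta q ^ 6) *
      Polynomial.X ^ 2 + Polynomial.C ((q : ℂ) * zeta q ^ 6)) := by
  simp only [Lagrange.nodal, Fin.prod_univ_succ, eigs, ← sqrtq_sq hq]
  simp
  ring

/-- The eigenvalues come in pairs ±λ, so the nodal polynomial is a product of factors in X². The
factor X² - 1 kills tensors with a factor in V_0, where Φ^ is the flip; the quartic factor kills the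
copies of V_{1/2} ⊗ V_{1/2}. -/
theorem aeval_braidVh_nodal (hq : 0 < q) :
    Polynomial.aeval (braidVh q) (Lagrange.nodal Finset.univ (eigs q)) = 0 := by
  have h : ∀ k l x, Polynomial.aeval (braidVh q) (Polynomial.X ^ 4 -
      Polynomial.C ((q : ℂ) + zeta q ^ 6) * Polynomial.X ^ 2 +
        Polynomial.C ((q : ℂ) * zeta q ^ 6)) (TensorProduct.map (inclV k) (inclV l) x) = 0 := by
    intro k l x
    simp only [map_add, map_sub, map_mul, Polynomial.aeval_X, Polynomial.aeval_C,
      LinearMap.add_apply, LinearMap.sub_apply, Module.End.mul_apply, pow_succ, pow_zero, one_mul,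
      braidVh_inr, braid_sq_sq hq, Module.algebraMap_end_apply, map_smul]
    module
  rw [nodal_eigs hq, map_mul]
  refine Vh_tensor_ext (fun k n => ?_) (fun n k => ?_) fun k l x => ?_
  -- The two factors commute; on tensors with a factor in V_0 it is X² - 1 that has to act first.
  · rw [← map_mul, mul_comm, map_mul, Module.End.mul_apply]
    simp [pow_two, braidVh_inl_left, braidVh_inl_right, -map_add]
  · rw [← map_mul, mul_comm, map_mul, Module.End.mul_apply]
    simp [pow_two, braidVh_inl_left, braidVh_inl_right, -map_add]
  · rw [Module.End.mul_apply, h, map_zero, LinearMap.zero_apply]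

/-- Multiplying the Lagrange basis polynomial by the missing factor X - λ_i gives a scalar multiple
of the nodal polynomial, which vanishes at Φ^. -/
theorem aeval_basis_mem_eigen (hq : 0 < q) (i : Fin 6) (x : Vh ⊗[ℂ] Vh) :
    Polynomial.aeval (braidVh q) (Lagrange.basis Finset.univ (eigs q) i) x ∈
      eigen (braidVh q) (eigs q i) := by
  have h : (Polynomial.X - Polynomial.C (eigs q i)) * Lagrange.basis Finset.univ (eigs q) i =
      Polynomial.C (∏ j ∈ Finset.univ.erase i, (eigs q i - eigs q j)⁻¹) *
        Lagrange.nodal Finset.univ (eigs q) := by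
    rw [Lagrange.nodal, ← Finset.mul_prod_erase _ _ (Finset.mem_univ i), Lagrange.basis]
    simp only [Lagrange.basisDivisor, Finset.prod_mul_distrib, map_prod]
    ring
  have h' := congrArg (fun p => Polynomial.aeval (braidVh q) p x) h
  simp only [map_mul, aeval_braidVh_nodal hq, mul_zero, map_sub, Polynomial.aeval_X,
    Polynomial.aeval_C, Module.End.mul_apply, LinearMap.sub_apply, LinearMap.zero_apply] at h'
  exact sub_eq_zero.1 h'

theorem asymPart_mem_asymVh (hq : 0 < q) (x : Vh ⊗[ℂ] Vh) : asymPart q x ∈ asymVh q := by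
  have h := aeval_basis_mem_eigen hq
  have e : asymPart q x =
      Polynomial.aeval (braidVh q) (Lagrange.basis Finset.univ (eigs q) 3) x +
      Polynomial.aeval (braidVh q) (Lagrange.basis Finset.univ (eigs q) 4) x +
      Polynomial.aeval (braidVh q) (Lagrange.basis Finset.univ (eigs q) 5) x := by
    simp [asymPart, Lagrange.interpolate_apply, Fin.sum_univ_six]
  rw [e]
  exact add_mem (Submodule.mem_sup_left (add_mem (Submodule.mem_sup_left (h 3 x))
    (Submodule.mem_sup_right (h 4 x)))) (Submodule.mem_sup_right (h 5 x))

end Braid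

/-! ### Tensor product coactions -/

section Coactions
variable {K K' : Type*} [Semiring K] [Algebra ℂ K] [Semiring K'] [Algebra ℂ K']
  {M M' N N' : Type*} [AddCommMonoid M] [Module ℂ M] [AddCommMonoid M'] [Module ℂ M']
  [AddCommMonoid N] [Module ℂ N] [AddCommMonoid N'] [Module ℂ N']

theorem matrixCoact_basisFun {ι : Type} [Fintype ι] [DecidableEq ι] (T : ι → ι → K) (j : ι) :
    matrixCoact T (Pi.basisFun ℂ ι j) = ∑ i, Pi.basisFun ℂ ι i ⊗ₜ[ℂ] T i j :=
  (Pi.basisFun ℂ ι).constr_basis ℂ _ j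

/-- The bilinear map `(m ⊗ k, n ⊗ l) ↦ (m ⊗ n) ⊗ k l`. -/
def mulCoact : (M ⊗[ℂ] K) ⊗[ℂ] (N ⊗[ℂ] K) →ₗ[ℂ] (M ⊗[ℂ] N) ⊗[ℂ] K :=
  LinearMap.lTensor (M ⊗[ℂ] N) (LinearMap.mul' ℂ K) ∘ₗ
    (TensorProduct.tensorTensorTensorComm ℂ M K N K).toLinearMap

theorem mulCoact_tmul (m : M) (k : K) (n : N) (l : K) :
    mulCoact ((m ⊗ₜ[ℂ] k) ⊗ₜ[ℂ] (n ⊗ₜ[ℂ] l)) = (m ⊗ₜ[ℂ] n) ⊗ₜ[ℂ] (k * l) := by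
  simp [mulCoact]

theorem tensorCoact_tmul (δM : M →ₗ[ℂ] M ⊗[ℂ] K) (δN : N →ₗ[ℂ] N ⊗[ℂ] K) (m : M) (n : N) :
    tensorCoact δM δN (m ⊗ₜ n) = mulCoact (δM m ⊗ₜ δN n) := rfl

theorem map_mulCoact (f : M →ₗ[ℂ] M') (g : N →ₗ[ℂ] N') (κ : K →ₐ[ℂ] K')
    (x : (M ⊗[ℂ] K) ⊗[ℂ] (N ⊗[ℂ] K)) :
    TensorProduct.map (TensorProduct.map f g) κ.toLinearMap (mulCoact x) =
      mulCoact (TensorProduct.map (TensorProduct.map f κ.toLinearMap)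
        (TensorProduct.map g κ.toLinearMap) x) := by
  suffices TensorProduct.map (TensorProduct.map f g) κ.toLinearMap ∘ₗ mulCoact =
      mulCoact ∘ₗ TensorProduct.map (TensorProduct.map f κ.toLinearMap)
        (TensorProduct.map g κ.toLinearMap) from LinearMap.congr_fun this x
  ext m k n l
  simp [mulCoact_tmul]

/-- The change of coefficients κ serves three purposes: it is `projUH` for j, the identity for the
inclusions of V_{1/2}, and `triRepHH` for the triangular representation. It has to be multiplicative
because tensor product coactions multiply coefficients. -/
theorem tensorCoact_map {δM : M →ₗ[ℂ] M ⊗[ℂ] K} {δN : N →ₗ[ℂ] N ⊗[ℂ] K}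
    {δM' : M' →ₗ[ℂ] M' ⊗[ℂ] K'} {δN' : N' →ₗ[ℂ] N' ⊗[ℂ] K'}
    {f : M →ₗ[ℂ] M'} {g : N →ₗ[ℂ] N'} {κ : K →ₐ[ℂ] K'}
    (hf : δM' ∘ₗ f = TensorProduct.map f κ.toLinearMap ∘ₗ δM)
    (hg : δN' ∘ₗ g = TensorProduct.map g κ.toLinearMap ∘ₗ δN) :
    tensorCoact δM' δN' ∘ₗ TensorProduct.map f g =
      TensorProduct.map (TensorProduct.map f g) κ.toLinearMap ∘ₗ tensorCoact δM δN := by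
  ext m n
  simp only [TensorProduct.AlgebraTensorModule.curry_apply, LinearMap.restrictScalars_self,
    TensorProduct.curry_apply, LinearMap.comp_apply, TensorProduct.map_tmul, tensorCoact_tmul,
    map_mulCoact]
  rw [← LinearMap.comp_apply δM', ← LinearMap.comp_apply δN', hf, hg]
  rfl

theorem mem_coinv {δ : M →ₗ[ℂ] M ⊗[ℂ] K} {m : M} : m ∈ coinv δ ↔ δ m = m ⊗ₜ 1 := Iff.rfl

theorem map_mem_coinv {δ : M →ₗ[ℂ] M ⊗[ℂ] K} {δ' : M' →ₗ[ℂ] M' ⊗[ℂ] K'} {f : M →ₗ[ℂ] M'}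
    {κ : K →ₐ[ℂ] K'} (h : δ' ∘ₗ f = TensorProduct.map f κ.toLinearMap ∘ₗ δ) {m : M}
    (hm : m ∈ coinv δ) : f m ∈ coinv δ' := by
  rw [mem_coinv] at hm ⊢
  rw [← LinearMap.comp_apply, h, LinearMap.comp_apply, hm]
  simp

end Coactions

/-! ### Covariance of the braidings -/

section Relations
variable (q : ℝ)

theorem su_rel {x y : FreeAlgebra ℂ (Fin 2 × Fin 2)} (h : SURel q x y) : suMk q x = suMk q y :=
  RingQuot.mkAlgHom_rel ℂ h

theorem su_ab : suMat q 0 0 * suMat q 0 1 = (q : ℂ) • (suMat q 0 1 * suMat q 0 0) := by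
  simpa [suMat, -Complex.coe_smul] using su_rel q SURel.ab

theorem su_ac : suMat q 0 0 * suMat q 1 0 = (q : ℂ) • (suMat q 1 0 * suMat q 0 0) := by
  simpa [suMat, -Complex.coe_smul] using su_rel q SURel.ac

theorem su_bd : suMat q 0 1 * suMat q 1 1 = (q : ℂ) • (suMat q 1 1 * suMat q 0 1) := by
  simpa [suMat, -Complex.coe_smul] using su_rel q SURel.bd

theorem su_cd : suMat q 1 0 * suMat q 1 1 = (q : ℂ) • (suMat q 1 1 * suMat q 1 0) := by
  simpa [suMat, -Complex.coe_smul] using su_rel q SURel.cd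

theorem su_bc : suMat q 0 1 * suMat q 1 0 = suMat q 1 0 * suMat q 0 1 := by
  simpa [suMat, -Complex.coe_smul] using su_rel q SURel.bc

theorem su_ad : suMat q 0 0 * suMat q 1 1 =
    suMat q 1 1 * suMat q 0 0 + sig q • (suMat q 1 0 * suMat q 0 1) := by
  rw [← su_bc, ← sub_eq_iff_eq_add']
  simpa [suMat, -Complex.coe_smul] using su_rel q SURel.ad

end Relations

section Covariance
variable {q : ℝ}

/-- `V_{1/2}` with the `U(1)`-part of its coaction given by `t`. -/
noncomputable def coactUV (q : ℝ) (t : U1) : C2 →ₗ[ℂ] C2 ⊗[ℂ] UH q := matrixCoact fun i j => t ⊗ₜ suMat q i j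

theorem coactUV_e2 (t : U1) (j : Fin 2) : coactUV q t (e2 j) =
    e2 0 ⊗ₜ[ℂ] (t ⊗ₜ[ℂ] suMat q 0 j) + e2 1 ⊗ₜ[ℂ] (t ⊗ₜ[ℂ] suMat q 1 j) :=
  (matrixCoact_basisFun (fun i j => t ⊗ₜ[ℂ] suMat q i j) j).trans (Fin.sum_univ_two _)

/-- This is the relation between R and the matrix (a b; c d), with the U(1)-parts s and t flipped
along. The relations above are oriented so that rewriting puts every quadratic word in the order d,
c, b, a; comparing coefficients then leaves identities in q. -/
theorem braid_covariant (hq : 0 < q) (s t : U1) :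
    tensorCoact (coactUV q t) (coactUV q s) ∘ₗ braid q =
      TensorProduct.map (braid q) LinearMap.id ∘ₗ
        tensorCoact (coactUV q s) (coactUV q t) := by
  have h0 := sqrtq_ne_zero hq
  refine ((Pi.basisFun ℂ (Fin 2)).tensorProduct (Pi.basisFun ℂ (Fin 2))).ext fun p => ?_
  rw [Module.Basis.tensorProduct_apply, basisFun_eq_e2, basisFun_eq_e2]
  rcases p with ⟨i, j⟩
  simp only [LinearMap.comp_apply]
  have hts : t * s = s * t := mul_comm t s
  fin_cases i <;> fin_cases j <;>
    simp only [Fin.zero_eta, Fin.mk_one, braid_e2, map_smul, map_add, smul_smul, smul_add,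
      tensorCoact_tmul, coactUV_e2, TensorProduct.add_tmul, TensorProduct.tmul_add, mulCoact_tmul,
      TensorProduct.map_tmul, LinearMap.id_apply, TensorProduct.tmul_smul,
      ← TensorProduct.smul_tmul', Algebra.TensorProduct.tmul_mul_tmul, hts,
      su_ab, su_ac, su_bd, su_cd, su_bc, su_ad] <;>
    match_scalars <;>
    first | ring1 | (simp only [zeta, sig, ← sqrtq_sq hq]; field_simp <;> ring1)

theorem coactVh_inl (k : Fin 3) :
    coactVh q (eh (Sum.inl k)) = eh (Sum.inl k) ⊗ₜ (LaurentPolynomial.T (wt1 k) ⊗ₜ 1) := by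
  rw [coactVh, eh, matrixCoact_basisFun, Fintype.sum_sum_type]
  simp only [TensorProduct.tmul_zero, Finset.sum_const_zero, add_zero]
  rw [Finset.sum_eq_single k]
  · simp
  · intro b _ hb; simp [hb]
  · simp

theorem coactVh_inr (k j : Fin 2) :
    coactVh q (eh (Sum.inr (k, j))) = ∑ i, eh (Sum.inr (k, i)) ⊗ₜ
      (LaurentPolynomial.T (wt2 k) ⊗ₜ suMat q i j) := by
  rw [coactVh, eh, matrixCoact_basisFun, Fintype.sum_sum_type, Fintype.sum_prod_type]
  simp only [TensorProduct.tmul_zero, Finset.sum_const_zero, zero_add]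
  rw [Finset.sum_eq_single k]
  · simp [eh]
  · intro b _ hb; simp [hb]
  · simp

theorem coactVh_comp_inclV (k : Fin 2) : coactVh q ∘ₗ inclV k =
    TensorProduct.map (inclV k) (AlgHom.id ℂ (UH q)).toLinearMap ∘ₗ
      coactUV q (LaurentPolynomial.T (wt2 k)) := by
  refine (Pi.basisFun ℂ (Fin 2)).ext fun j => ?_
  rw [basisFun_eq_e2, LinearMap.comp_apply, LinearMap.comp_apply, inclV_e2, coactVh_inr,
    coactUV_e2]
  simp [inclV_e2]

/-- The coefficients of the one-dimensional summands of V^ are central, so the flip is covariant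
wherever a factor V_0 occurs. -/
theorem tmul_one_mul_comm (t : U1) (z : UH q) : (t ⊗ₜ[ℂ] (1 : SUq q)) * z = z * (t ⊗ₜ 1) := by
  induction z using TensorProduct.induction_on with
  | zero => simp
  | add x y hx hy => rw [mul_add, add_mul, hx, hy]
  | tmul x y => simp [mul_comm]

theorem braidVh_mulCoact_left (k : Fin 3) (t : U1) (y : Vh ⊗[ℂ] UH q) :
    TensorProduct.map (braidVh q) LinearMap.id
        (mulCoact ((eh (Sum.inl k) ⊗ₜ (t ⊗ₜ 1)) ⊗ₜ y)) =
      mulCoact (y ⊗ₜ (eh (Sum.inl k) ⊗ₜ (t ⊗ₜ 1))) := by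
  have h : ∀ v, braidVh q (eh (Sum.inl k) ⊗ₜ v) = v ⊗ₜ eh (Sum.inl k) := fun v =>
    LinearMap.congr_fun (f := braidVh q ∘ₗ TensorProduct.mk ℂ Vh Vh (eh (Sum.inl k)))
      (g := (TensorProduct.mk ℂ Vh Vh).flip (eh (Sum.inl k)))
      ((Pi.basisFun ℂ TwIdx).ext fun n => braidVh_inl_left q k n) v
  induction y with
  | zero => simp
  | add x y hx hy => simp only [TensorProduct.tmul_add, TensorProduct.add_tmul, map_add, hx, hy]
  | tmul v z => simp only [mulCoact_tmul, TensorProduct.map_tmul, h, tmul_one_mul_comm,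
      LinearMap.id_apply]

theorem braidVh_mulCoact_right (k : Fin 3) (t : U1) (y : Vh ⊗[ℂ] UH q) :
    TensorProduct.map (braidVh q) LinearMap.id
        (mulCoact (y ⊗ₜ (eh (Sum.inl k) ⊗ₜ (t ⊗ₜ 1)))) =
      mulCoact ((eh (Sum.inl k) ⊗ₜ (t ⊗ₜ 1)) ⊗ₜ y) := by
  have h : ∀ v, braidVh q (v ⊗ₜ eh (Sum.inl k)) = eh (Sum.inl k) ⊗ₜ v := fun v =>
    LinearMap.congr_fun (f := braidVh q ∘ₗ (TensorProduct.mk ℂ Vh Vh).flip (eh (Sum.inl k)))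
      (g := TensorProduct.mk ℂ Vh Vh (eh (Sum.inl k)))
      ((Pi.basisFun ℂ TwIdx).ext fun n => braidVh_inl_right q n k) v
  induction y with
  | zero => simp
  | add x y hx hy => simp only [TensorProduct.tmul_add, TensorProduct.add_tmul, map_add, hx, hy]
  | tmul v z => simp only [mulCoact_tmul, TensorProduct.map_tmul, h, tmul_one_mul_comm,
      LinearMap.id_apply]

theorem braidVh_covariant (hq : 0 < q) :
    tensorCoact (coactVh q) (coactVh q) ∘ₗ braidVh q =
      TensorProduct.map (braidVh q) LinearMap.id ∘ₗ tensorCoact (coactVh q) (coactVh q) := by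
  refine Vh_tensor_ext (fun k n => ?_) (fun n k => ?_) fun k l x => ?_
  · simp only [LinearMap.comp_apply, braidVh_inl_left, tensorCoact_tmul, coactVh_inl,
      braidVh_mulCoact_left]
  · simp only [LinearMap.comp_apply, braidVh_inl_right, tensorCoact_tmul, coactVh_inl,
      braidVh_mulCoact_right]
  · have h : ∀ k l y, tensorCoact (coactVh q) (coactVh q)
        (TensorProduct.map (inclV k) (inclV l) y) =
        TensorProduct.map (TensorProduct.map (inclV k) (inclV l)) LinearMap.id
          (tensorCoact (coactUV q (LaurentPolynomial.T (wt2 k)))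
            (coactUV q (LaurentPolynomial.T (wt2 l))) y) := fun k l y =>
      LinearMap.congr_fun (tensorCoact_map (coactVh_comp_inclV k) (coactVh_comp_inclV l)) y
    simp only [LinearMap.comp_apply, braidVh_inr, h]
    rw [← LinearMap.comp_apply _ (braid q), braid_covariant hq, LinearMap.comp_apply,
      ← LinearMap.comp_apply, ← TensorProduct.map_comp,
      ← LinearMap.comp_apply (TensorProduct.map _ _) (TensorProduct.map _ _), ← TensorProduct.map_comp]
    congr 2
    exact LinearMap.ext fun y => (braidVh_inr q k l y).symm

theorem asymPart_covariant (hq : 0 < q) :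
    tensorCoact (coactVh q) (coactVh q) ∘ₗ asymPart q =
      TensorProduct.map (asymPart q) (AlgHom.id ℂ (UH q)).toLinearMap ∘ₗ
        tensorCoact (coactVh q) (coactVh q) := by
  rw [asymPart]
  generalize Lagrange.interpolate Finset.univ (eigs q) ![0, 0, 0, 1, 1, 1] = p
  change _ = LinearMap.rTensor (UH q) _ ∘ₗ _
  induction p using Polynomial.induction_on' with
  | add p r hp hr => rw [map_add, LinearMap.comp_add, hp, hr, LinearMap.rTensor_add,
      LinearMap.add_comp]
  | monomial n a =>
    rw [Polynomial.aeval_monomial, ← Algebra.smul_def, LinearMap.comp_smul, LinearMap.rTensor_smul,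
      LinearMap.smul_comp]
    congr 1
    induction n with
    | zero => exact LinearMap.ext fun x => by simp [Module.End.one_eq_id]
    | succ n ih =>
      rw [pow_succ, Module.End.mul_eq_comp, ← LinearMap.comp_assoc, ih, LinearMap.comp_assoc,
        braidVh_covariant hq, LinearMap.rTensor_comp, LinearMap.comp_assoc]
      rfl

/-! ### Covariance of j and of the push-out -/

theorem projU1_suMat (i j : Fin 2) : projU1 q (suMat q i j) =
    if i = j then (if i = 0 then LaurentPolynomial.T 1 else LaurentPolynomial.T (-1)) else 0 := by
  rw [projU1, suMat, suMk]
  refine (RingQuot.liftAlgHom_mkAlgHom_apply ℂ _ _ _).trans ?_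
  simp [u1Free, suGen]

theorem coactVt_e2 (j : Fin 2) : coactVt q (e2 j) =
    ∑ i, e2 i ⊗ₜ[ℂ] (suAntipodeInv q i j ⊗ₜ[ℂ] (1 : SUq q)) :=
  matrixCoact_basisFun _ j

theorem coactV_e2 (j : Fin 2) : coactV q (e2 j) =
    ∑ i, e2 i ⊗ₜ[ℂ] ((1 : SUq q) ⊗ₜ[ℂ] suMat q i j) :=
  matrixCoact_basisFun _ j

/-- Since π kills b and c, the matrix of S~ becomes diag(t⁻¹, t): x~ acquires weight -1 and y~
weight 1, as in the definition of j. -/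
theorem jmap_covariant :
    coactVh q ∘ₗ jmap = TensorProduct.map jmap (projUH q).toLinearMap ∘ₗ coactW q := by
  refine ((Pi.basisFun ℂ (Fin 2)).tensorProduct (Pi.basisFun ℂ (Fin 2))).ext fun p => ?_
  rw [Module.Basis.tensorProduct_apply, basisFun_eq_e2, basisFun_eq_e2]
  rcases p with ⟨i, j⟩
  simp only [LinearMap.comp_apply, jmap_e2, coactVh_inr, coactW, tensorCoact_tmul, coactVt_e2,
    coactV_e2]
  fin_cases i <;>
  simp [TensorProduct.add_tmul, TensorProduct.tmul_add, mulCoact_tmul, jmap_e2, projUH,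
    suAntipodeInv, projU1_suMat, wt2, -Complex.coe_smul]

theorem pushOut_mem_coinvCP3 (hq : 0 < q) {ω : Spq q ⊗[ℂ] (W ⊗[ℂ] W)} (hω : ω ∈ coinvS4 q) :
    pushOut q ω ∈ coinvCP3 q := by
  have hj : tensorCoact (coactVh q) (coactVh q) ∘ₗ jmap2 q =
      TensorProduct.map (jmap2 q) (projUH q).toLinearMap ∘ₗ
        tensorCoact (coactW q) (coactW q) := by
    rw [jmap2, ← LinearMap.comp_assoc, asymPart_covariant hq, LinearMap.comp_assoc,
      tensorCoact_map jmap_covariant jmap_covariant, ← LinearMap.comp_assoc,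
      ← TensorProduct.map_comp]
    rfl
  exact map_mem_coinv (tensorCoact_map (f := LinearMap.id) rfl hj) hω

theorem pushOut_mem_twoFormsCP3 (hq : 0 < q) {ω : Spq q ⊗[ℂ] (W ⊗[ℂ] W)} (hω : ω ∈ coinvS4 q) :
    pushOut q ω ∈ twoFormsCP3 q := by
  refine ⟨pushOut_mem_coinvCP3 hq hω, ?_⟩
  let f : W ⊗[ℂ] W →ₗ[ℂ] asymVh q := (jmap2 q).codRestrict _ fun x => asymPart_mem_asymVh hq _
  exact ⟨LinearMap.lTensor _ f ω, by rw [← LinearMap.lTensor_comp_apply]; rfl⟩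

end Covariance

/-! ### Coordinates on `ℂ² ⊗ ℂ²` and a left eigenvector of `Ψ` -/

/-- The coordinate functionals of the basis `e_i ⊗ e_j`. -/
noncomputable def coord2 (i j : Fin 2) : C2 ⊗[ℂ] C2 →ₗ[ℂ] ℂ :=
  ((Pi.basisFun ℂ (Fin 2)).tensorProduct (Pi.basisFun ℂ (Fin 2))).coord (i, j)

theorem coord2_e2 (i j k l : Fin 2) :
    coord2 i j (e2 k ⊗ₜ e2 l) = if k = i ∧ l = j then 1 else 0 := by
  have := ((Pi.basisFun ℂ (Fin 2)).tensorProduct (Pi.basisFun ℂ (Fin 2))).repr_self_apply (k, l)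
    (i, j)
  rw [Module.Basis.tensorProduct_apply] at this
  rw [← if_congr Prod.mk_inj rfl rfl]
  exact this

theorem sum_coord2 (u : C2 ⊗[ℂ] C2) :
    u = coord2 0 0 u • (e2 0 ⊗ₜ e2 0) + coord2 0 1 u • (e2 0 ⊗ₜ e2 1) +
      (coord2 1 0 u • (e2 1 ⊗ₜ e2 0) + coord2 1 1 u • (e2 1 ⊗ₜ e2 1)) := by
  have := ((Pi.basisFun ℂ (Fin 2)).tensorProduct (Pi.basisFun ℂ (Fin 2))).sum_repr u
  rw [Fintype.sum_prod_type] at this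
  simp only [Module.Basis.tensorProduct_apply, Fin.sum_univ_two] at this
  exact this.symm

section Functionals
variable (q : ℝ)

/-- The functional on `V_{1/2} ⊗ V_{1/2}` which is, up to normalisation, the projection to the spin
zero component. -/
noncomputable def spin0Fun : C2 ⊗[ℂ] C2 →ₗ[ℂ] ℂ := coord2 0 1 - (q : ℂ) • coord2 1 0

/-- The functional `g ⊗ spin0Fun` on `W ⊗ W`. -/
noncomputable def funW (g : C2 ⊗[ℂ] C2 →ₗ[ℂ] ℂ) : W ⊗[ℂ] W →ₗ[ℂ] ℂ :=
  LinearMap.mul' ℂ ℂ ∘ₗ TensorProduct.map g (spin0Fun q) ∘ₗ midFlip.toLinearMap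

theorem funW_tmul (g : C2 ⊗[ℂ] C2 →ₗ[ℂ] ℂ) (a b c d : C2) :
    funW q g ((a ⊗ₜ b) ⊗ₜ (c ⊗ₜ d)) = g (a ⊗ₜ c) * spin0Fun q (b ⊗ₜ d) := by
  simp [funW, midFlip]

/-- The coordinate functionals of `V^ ⊗ V^`. -/
noncomputable def coordVh (m n : TwIdx) : Vh ⊗[ℂ] Vh →ₗ[ℂ] ℂ :=
  LinearMap.mul' ℂ ℂ ∘ₗ TensorProduct.map (LinearMap.proj m) (LinearMap.proj n)

theorem coordVh_tmul (m n : TwIdx) (v w : Vh) : coordVh m n (v ⊗ₜ w) = v m * w n := by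
  simp [coordVh]

theorem eh_apply (m n : TwIdx) : eh m n = if n = m then 1 else 0 := by
  simp [eh, Pi.single_apply]

/-- The functional on `V^ ⊗ V^` which is `spin0Fun` on `(U_k ⊗ V_{1/2}) ⊗ (U_k ⊗ V_{1/2})`. -/
noncomputable def funVh (k : Fin 2) : Vh ⊗[ℂ] Vh →ₗ[ℂ] ℂ :=
  coordVh (Sum.inr (k, 0)) (Sum.inr (k, 1)) - (q : ℂ) • coordVh (Sum.inr (k, 1)) (Sum.inr (k, 0))

theorem funVh_tmul (k : Fin 2) (v w : Vh) : funVh q k (v ⊗ₜ w) =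
    v (Sum.inr (k, 0)) * w (Sum.inr (k, 1)) - q * (v (Sum.inr (k, 1)) * w (Sum.inr (k, 0))) := by
  simp [funVh, coordVh_tmul, -Complex.coe_smul]

theorem funVh_inr (k l m : Fin 2) (x : C2 ⊗[ℂ] C2) :
    funVh q k (TensorProduct.map (inclV l) (inclV m) x) =
      if l = k ∧ m = k then spin0Fun q x else 0 := by
  rw [sum_coord2 x]
  simp only [map_add, map_smul, TensorProduct.map_tmul, inclV_e2, funVh_tmul, eh_apply, spin0Fun,
    LinearMap.sub_apply, LinearMap.smul_apply, coord2_e2]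
  fin_cases k <;> fin_cases l <;> fin_cases m <;> simp [mul_comm]

/-- The index is reversed because j sends the basis vector number i of V~_{1/2} to the summand
labelled 1 - i. The pull-backs are the extremal weight functionals on V~_1 ⊗ V_0. -/
theorem funVh_jmap (k : Fin 2) :
    funVh q k ∘ₗ TensorProduct.map jmap jmap = funW q (coord2 (1 - k) (1 - k)) := by
  let B := (Pi.basisFun ℂ (Fin 2)).tensorProduct (Pi.basisFun ℂ (Fin 2))
  refine (B.tensorProduct B).ext fun p => ?_
  rcases p with ⟨⟨a, b⟩, ⟨c, d⟩⟩
  simp only [Module.Basis.tensorProduct_apply, B, basisFun_eq_e2, LinearMap.comp_apply, funW_tmul,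
    TensorProduct.map_tmul, jmap_e2, funVh_tmul, eh_apply, spin0Fun, LinearMap.sub_apply,
    LinearMap.smul_apply, coord2_e2]
  fin_cases k <;> fin_cases a <;> fin_cases c <;> fin_cases b <;> fin_cases d <;> simp

variable {q}

theorem spin0Fun_braid (hq : 0 < q) (x : C2 ⊗[ℂ] C2) :
    spin0Fun q (braid q x) = -(zeta q) ^ 3 * spin0Fun q x := by
  have h0 := sqrtq_ne_zero hq
  nth_rw 1 [sum_coord2 x]
  simp only [map_add, map_smul, braid_e2, spin0Fun, LinearMap.sub_apply, LinearMap.smul_apply,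
    coord2_e2]
  simp only [zeta, sig, ← sqrtq_sq hq, smul_eq_mul]
  simp
  field_simp
  ring

/-- On the block where both labels equal k their exchange is invisible, so the left eigenvector
`spin0Fun` of Ψ yields one of Φ^. -/
theorem funVh_braidVh (hq : 0 < q) (k : Fin 2) :
    funVh q k ∘ₗ braidVh q = (-(zeta q) ^ 3) • funVh q k := by
  refine Vh_tensor_ext (fun k n => ?_) (fun n k => ?_) fun k l x => ?_
  · simp [braidVh_inl_left, funVh_tmul, eh_apply]
  · simp [braidVh_inl_right, funVh_tmul, eh_apply]
  · simp only [LinearMap.comp_apply, braidVh_inr, funVh_inr, spin0Fun_braid hq,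
      LinearMap.smul_apply, smul_eq_mul, mul_ite, mul_zero, and_comm]

theorem comp_aeval {V N : Type*} [AddCommMonoid V] [Module ℂ V] [AddCommMonoid N] [Module ℂ N]
    {f : V →ₗ[ℂ] N} {Φ : Module.End ℂ V} {c : ℂ} (h : f ∘ₗ Φ = c • f) (p : Polynomial ℂ) :
    f ∘ₗ Polynomial.aeval Φ p = p.eval c • f := by
  induction p using Polynomial.induction_on' with
  | add p r hp hr => rw [map_add, LinearMap.comp_add, hp, hr, Polynomial.eval_add, add_smul]
  | monomial n a =>
    rw [Polynomial.aeval_monomial, ← Algebra.smul_def, LinearMap.comp_smul,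
      Polynomial.eval_monomial, mul_smul]
    congr 1
    induction n with
    | zero => simp [Module.End.one_eq_id]
    | succ n ih =>
      rw [pow_succ, Module.End.mul_eq_comp, ← LinearMap.comp_assoc, ih, LinearMap.smul_comp, h,
        smul_smul, pow_succ]

/-- On a left eigenvector a polynomial in Φ^ acts by its value at the eigenvalue. Here this is the
last node, where the interpolation polynomial equals 1. -/
theorem funVh_asymPart (hq0 : 0 < q) (hq1 : q < 1) (k : Fin 2) :
    funVh q k ∘ₗ asymPart q = funVh q k := by
  rw [asymPart, comp_aeval (funVh_braidVh hq0 k)]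
  have := Lagrange.eval_interpolate_at_node (s := Finset.univ) ![0, 0, 0, 1, 1, 1]
    (eigs_injective hq0 hq1).injOn (Finset.mem_univ (5 : Fin 6))
  change Polynomial.eval (-(zeta q) ^ 3) _ = (1 : ℂ) at this
  rw [this, one_smul]

/-! ### Vanishing of the extremal components on type (1,0,1) -/

theorem apply_eq_zero_of_mem_Tpart {s : SignType} {v : Vh} (hv : v ∈ Tpart s) {n : TwIdx}
    (hn : SignType.sign (wt n) ≠ s) : v n = 0 := by
  suffices Tpart s ≤ LinearMap.ker (LinearMap.proj n : Vh →ₗ[ℂ] ℂ) from this hv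
  refine Submodule.span_le.2 ?_
  rintro _ ⟨m, hm, rfl⟩
  change eh m n = 0
  rw [eh_apply, if_neg]
  rintro rfl
  exact hn hm

/-- The functional ignores the projection in v ∧_q w and involves only products of coordinates of v
and w of the same weight. The signs of v and w differ, so one factor is always zero. -/
theorem typeVh_le_ker (hq0 : 0 < q) (hq1 : q < 1) (k : Fin 2) :
    typeVh q 1 0 1 ≤ LinearMap.ker (funVh q k) := by
  refine Submodule.span_le.2 ?_
  rintro _ ⟨s, t, hst, v, hv, w, hw, rfl⟩
  have hne : s ≠ t := by
    rintro rfl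
    revert hst
    cases s <;> decide
  change (funVh q k ∘ₗ asymPart q) (v ⊗ₜ w) = 0
  have hwt : ∀ i j, wt (Sum.inr (k, i)) = wt (Sum.inr (k, j)) := fun _ _ => rfl
  have h : ∀ i j, v (Sum.inr (k, i)) * w (Sum.inr (k, j)) = 0 := by
    intro i j
    by_cases hs : SignType.sign (wt (Sum.inr (k, i))) = s
    · rw [apply_eq_zero_of_mem_Tpart hw (by rw [hwt j i, hs]; exact hne), mul_zero]
    · rw [apply_eq_zero_of_mem_Tpart hv hs, zero_mul]
  rw [funVh_asymPart hq0 hq1, funVh_tmul, h, h, mul_zero, sub_zero]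

theorem lTensor_eq_zero_of_mem {P V : Type*} [AddCommMonoid P] [Module ℂ P] [AddCommMonoid V]
    [Module ℂ V] {N : Type*} [AddCommMonoid N] [Module ℂ N]
    {U : Submodule ℂ V} {f : V →ₗ[ℂ] N} (h : U ≤ LinearMap.ker f)
    {ω : P ⊗[ℂ] V} (hω : ω ∈ tensorSub P U) : LinearMap.lTensor P f ω = 0 := by
  obtain ⟨ω, rfl⟩ := hω
  have hf : f ∘ₗ U.subtype = 0 := LinearMap.ext fun x => h x.2
  rw [← LinearMap.lTensor_comp_apply, hf, LinearMap.lTensor_zero, LinearMap.zero_apply]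

theorem lTensor_funW_eq_zero (hq0 : 0 < q) (hq1 : q < 1) {ω : Spq q ⊗[ℂ] (W ⊗[ℂ] W)}
    (h : pushOut q ω ∈ tensorSub (Spq q) (typeVh q 1 0 1)) (k : Fin 2) :
    LinearMap.lTensor (Spq q) (funW q (coord2 k k)) ω = 0 := by
  obtain ⟨l, rfl⟩ : ∃ l, k = 1 - l := ⟨1 - k, by fin_cases k <;> rfl⟩
  -- The functional becomes `funVh` composed with j_*, so its value on ω depends only on the
  -- push-out of ω.
  rw [← funVh_jmap, ← funVh_asymPart hq0 hq1, LinearMap.comp_assoc]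
  have := lTensor_eq_zero_of_mem (typeVh_le_ker hq0 hq1 l) h
  rwa [pushOut, ← LinearMap.lTensor_comp_apply] at this

/-! ### Anti-self-dual forms are of type `(1,0,1)` -/

theorem jmap_mem_Tpart (v : C2) :
    jmap (e2 0 ⊗ₜ v) ∈ Tpart (-1) ∧ jmap (e2 1 ⊗ₜ v) ∈ Tpart 1 := by
  have h : ∀ (i : Fin 2) (s : SignType), (∀ j, SignType.sign (wt (Sum.inr (1 - i, j))) = s) →
      jmap (e2 i ⊗ₜ v) ∈ Tpart s := by
    intro i s hs
    rw [← (Pi.basisFun ℂ (Fin 2)).sum_repr v, TensorProduct.tmul_sum, map_sum]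
    refine Submodule.sum_mem _ fun j _ => ?_
    rw [TensorProduct.tmul_smul, map_smul, basisFun_eq_e2, jmap_e2]
    exact Submodule.smul_mem _ _ (Submodule.subset_span ⟨_, hs j, rfl⟩)
  exact ⟨h 0 _ fun _ => rfl, h 1 _ fun _ => rfl⟩

theorem sqrtq_add_zeta_ne_zero (hq : 0 < q) : sqrtq q + zeta q ^ 3 ≠ 0 := by
  have h : sqrtq q + zeta q ^ 3 = ((√q + (√q)⁻¹ ^ 3 : ℝ) : ℂ) := by simp [zeta, sqrtq]
  have h0 : 0 < √q := Real.sqrt_pos.2 hq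
  rw [h, Complex.ofReal_ne_zero]
  positivity

theorem coord2_braidt_diag (i : Fin 2) (u : C2 ⊗[ℂ] C2) :
    coord2 i i (braidt q u) = sqrtq q * coord2 i i u := by
  nth_rw 1 [sum_coord2 u]
  fin_cases i <;> simp [braidt_e2, coord2_e2, mul_comm]

/-- Ψ~ multiplies the coordinates at x~x~ and y~y~ by q^{1/2}, which differs from the eigenvalue
-q^{-3/2} of V~_0. -/
theorem coord2_of_mem_spin0t (hq : 0 < q) {u : C2 ⊗[ℂ] C2} (hu : u ∈ spin0t q) (i : Fin 2) :
    coord2 i i u = 0 := by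
  have h : sqrtq q * coord2 i i u = -zeta q ^ 3 * coord2 i i u := by
    rw [← coord2_braidt_diag, show braidt q u = (-zeta q ^ 3) • u from hu, map_smul, smul_eq_mul]
  refine (mul_eq_zero.1 (?_ : (sqrtq q + zeta q ^ 3) * _ = 0)).resolve_left
    (sqrtq_add_zeta_ne_zero hq)
  linear_combination h

theorem jmap2_midFlip_symm_mem_typeVh {u : C2 ⊗[ℂ] C2} (hu : ∀ i, coord2 i i u = 0)
    (v : C2 ⊗[ℂ] C2) : (jmap2 q ∘ₗ midFlip.symm.toLinearMap) (u ⊗ₜ v) ∈ typeVh q 1 0 1 := by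
  rw [sum_coord2 u, hu, hu, zero_smul, zero_add, zero_smul, add_zero, TensorProduct.add_tmul,
    ← TensorProduct.smul_tmul', ← TensorProduct.smul_tmul', map_add, map_smul, map_smul]
  induction v using TensorProduct.induction_on with
  | zero => simp only [TensorProduct.tmul_zero, map_zero, smul_zero, add_zero, zero_mem]
  | add x y hx hy =>
    simp only [TensorProduct.tmul_add, map_add, smul_add]
    rw [add_add_add_comm]
    exact add_mem hx hy
  | tmul x y =>
    refine add_mem (Submodule.smul_mem _ _ (Submodule.subset_span ⟨-1, 1, by decide,
      jmap (e2 0 ⊗ₜ x), (jmap_mem_Tpart x).1, jmap (e2 1 ⊗ₜ y), (jmap_mem_Tpart y).2, ?_⟩))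
      (Submodule.smul_mem _ _ (Submodule.subset_span ⟨1, -1, by decide,
      jmap (e2 1 ⊗ₜ x), (jmap_mem_Tpart x).2, jmap (e2 0 ⊗ₜ y), (jmap_mem_Tpart y).1, ?_⟩))
    all_goals simp [jmap2, wedgeVh, midFlip]

theorem asdW_le_comap_typeVh (hq : 0 < q) : asdW q ≤ (typeVh q 1 0 1).comap (jmap2 q) := by
  rw [asdW, Submodule.map_le_iff_le_comap]
  rintro _ ⟨x, rfl⟩
  change (jmap2 q ∘ₗ midFlip.symm.toLinearMap) _ ∈ typeVh q 1 0 1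
  induction x using TensorProduct.induction_on with
  | zero => simp only [map_zero, zero_mem]
  | add x y hx hy => simpa only [map_add] using add_mem hx hy
  | tmul u v => exact jmap2_midFlip_symm_mem_typeVh (coord2_of_mem_spin0t hq u.2) _

theorem map_mem_tensorSub {P V V' : Type*} [AddCommMonoid P] [Module ℂ P] [AddCommMonoid V]
    [Module ℂ V] [AddCommMonoid V'] [Module ℂ V'] {U : Submodule ℂ V} {U' : Submodule ℂ V'}
    {f : V →ₗ[ℂ] V'} (h : U ≤ U'.comap f) {ω : P ⊗[ℂ] V} (hω : ω ∈ tensorSub P U) :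
    LinearMap.lTensor P f ω ∈ tensorSub P U' := by
  obtain ⟨ω, rfl⟩ := hω
  refine ⟨LinearMap.lTensor P (f.restrict h) ω, ?_⟩
  rw [← LinearMap.lTensor_comp_apply, ← LinearMap.lTensor_comp_apply]
  rfl

end Functionals

/-! ### A triangular representation and the coinvariance of the component in `V~_1 ⊗ V_0` -/

section Representation
variable {q : ℝ}

/-- Two by two complex matrices. -/
abbrev M2 : Type := Matrix (Fin 2) (Fin 2) ℂ

/-- The values of `a, b, c, d` in the representation `a ↦ diag(q, 1)`, `b ↦ E₁₂`, `c ↦ 0`,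
`d ↦ diag(q⁻¹, 1)`. -/
noncomputable def triMat (q : ℝ) : Fin 2 → Fin 2 → M2 :=
  ![![!![(q : ℂ), 0; 0, 1], !![0, 1; 0, 0]], ![0, !![(q : ℂ)⁻¹, 0; 0, 1]]]

/-- Modulo c the relations reduce to d = a⁻¹ and ab = q ba, which the nilpotent matrix E₁₂ and
diag(q, 1) satisfy. Diagonal matrices alone would force b to be zero and lose the information needed
below. -/
theorem triMat_rel (hq : 0 < q) ⦃x y : FreeAlgebra ℂ (Fin 2 × Fin 2)⦄ (h : SURel q x y) :
    FreeAlgebra.lift ℂ (fun p => triMat q p.1 p.2) x =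
      FreeAlgebra.lift ℂ (fun p => triMat q p.1 p.2) y := by
  have h0 : (q : ℂ) ≠ 0 := Complex.ofReal_ne_zero.2 hq.ne'
  cases h <;> simp only [suGen, map_mul, map_sub, map_smul, map_one, FreeAlgebra.lift_ι_apply] <;>
    ext i j <;> fin_cases i <;> fin_cases j <;>
    simp [triMat, Matrix.mul_apply, Fin.sum_univ_two, h0, -Complex.coe_smul]

theorem one_rel (q : ℝ) ⦃x y : FreeAlgebra ℂ (Fin 2 × Fin 2)⦄ (h : SURel q x y) :
    FreeAlgebra.lift ℂ (fun p => if p.1 = p.2 then (1 : ℂ) else 0) x =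
      FreeAlgebra.lift ℂ (fun p => if p.1 = p.2 then (1 : ℂ) else 0) y := by
  cases h <;> simp [suGen, -Complex.coe_smul]

/-- The representation of `A[SU_q(2)]` by triangular matrices. -/
noncomputable def triRep (hq : 0 < q) : SUq q →ₐ[ℂ] M2 :=
  RingQuot.liftAlgHom ℂ ⟨_, triMat_rel hq⟩

/-- The counit of `A[SU_q(2)]`. -/
noncomputable def suCounit (q : ℝ) : SUq q →ₐ[ℂ] ℂ := RingQuot.liftAlgHom ℂ ⟨_, one_rel q⟩

theorem triRep_suMat (hq : 0 < q) (i j : Fin 2) : triRep hq (suMat q i j) = triMat q i j :=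
  (RingQuot.liftAlgHom_mkAlgHom_apply ℂ _ _ _).trans (FreeAlgebra.lift_ι_apply _ _)

theorem suCounit_suMat (q : ℝ) (i j : Fin 2) :
    suCounit q (suMat q i j) = if i = j then 1 else 0 :=
  (RingQuot.liftAlgHom_mkAlgHom_apply ℂ _ _ _).trans (FreeAlgebra.lift_ι_apply _ _)

/-- The representation of `H~ ⊗ H` by triangular matrices, trivial on `H`. -/
noncomputable def triRepHH (hq : 0 < q) : HH q →ₐ[ℂ] M2 :=
  (Algebra.TensorProduct.rid ℂ ℂ M2).toAlgHom.comp
    (Algebra.TensorProduct.map (triRep hq) (suCounit q))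

theorem triRepHH_tmul (hq : 0 < q) (x y : SUq q) :
    triRepHH hq (x ⊗ₜ y) = suCounit q y • triRep hq x := by
  simp [triRepHH]

/-- The images of the matrix `S~(a_i^j)`. -/
noncomputable def triMatInv (q : ℝ) : Fin 2 → Fin 2 → M2 :=
  ![![!![(q : ℂ)⁻¹, 0; 0, 1], !![0, -(q : ℂ); 0, 0]], ![0, !![(q : ℂ), 0; 0, 1]]]

theorem triRep_suAntipodeInv (hq : 0 < q) (i j : Fin 2) :
    triRep hq (suAntipodeInv q i j) = triMatInv q i j := by
  fin_cases i <;> fin_cases j <;>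
    simp [suAntipodeInv, triRep_suMat, triMat, triMatInv, -Complex.coe_smul]

/-- The coaction on `W` with its coefficients represented by triangular matrices. -/
noncomputable def triCoactW (hq : 0 < q) : W →ₗ[ℂ] W ⊗[ℂ] M2 :=
  TensorProduct.map LinearMap.id (triRepHH hq).toLinearMap ∘ₗ coactW q

theorem triCoactW_e2 (hq : 0 < q) (j l : Fin 2) : triCoactW hq (e2 j ⊗ₜ e2 l) =
    (e2 0 ⊗ₜ e2 l) ⊗ₜ triMatInv q 0 j + (e2 1 ⊗ₜ e2 l) ⊗ₜ triMatInv q 1 j := by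
  rw [triCoactW, LinearMap.comp_apply, coactW, tensorCoact_tmul, coactVt_e2, coactV_e2]
  fin_cases l <;>
  simp [TensorProduct.add_tmul, TensorProduct.tmul_add, mulCoact_tmul, triRepHH_tmul,
    suCounit_suMat, triRep_suAntipodeInv]

/-- Evaluation of a functional on the first factor. -/
noncomputable def evalLeft {N K : Type*} [AddCommMonoid N] [Module ℂ N] [AddCommMonoid K]
    [Module ℂ K] (E : N →ₗ[ℂ] ℂ) : N ⊗[ℂ] K →ₗ[ℂ] K :=
  (TensorProduct.lid ℂ K).toLinearMap ∘ₗ LinearMap.rTensor K E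

/-- Evaluation of a functional on the second factor. -/
noncomputable def evalRight {N P : Type*} [AddCommMonoid N] [Module ℂ N] [AddCommMonoid P]
    [Module ℂ P] (E : N →ₗ[ℂ] ℂ) : P ⊗[ℂ] N →ₗ[ℂ] P :=
  (TensorProduct.rid ℂ P).toLinearMap ∘ₗ LinearMap.lTensor P E

theorem evalLeft_tmul {N K : Type*} [AddCommMonoid N] [Module ℂ N] [AddCommMonoid K]
    [Module ℂ K] (E : N →ₗ[ℂ] ℂ) (n : N) (k : K) : evalLeft E (n ⊗ₜ[ℂ] k) = E n • k := by
  simp [evalLeft]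

theorem evalRight_tmul {N P : Type*} [AddCommMonoid N] [Module ℂ N] [AddCommMonoid P]
    [Module ℂ P] (E : N →ₗ[ℂ] ℂ) (p : P) (n : N) : evalRight E (p ⊗ₜ[ℂ] n) = E n • p := by
  simp [evalRight]

theorem evalRight_eq_zero {N P : Type*} [AddCommMonoid N] [Module ℂ N] [AddCommMonoid P]
    [Module ℂ P] {E : N →ₗ[ℂ] ℂ} {ω : P ⊗[ℂ] N} :
    evalRight E ω = 0 ↔ LinearMap.lTensor P E ω = 0 := by
  simp [evalRight]

theorem rTensor_evalRight_mulCoact {P N K : Type*} [Ring P] [Algebra ℂ P] [AddCommMonoid N]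
    [Module ℂ N] [Ring K] [Algebra ℂ K] (E : N →ₗ[ℂ] ℂ) (x : P ⊗[ℂ] K) (y : N ⊗[ℂ] K) :
    LinearMap.rTensor K (evalRight E) (mulCoact (x ⊗ₜ y)) =
      x * ((1 : P) ⊗ₜ[ℂ] evalLeft E y) := by
  induction x using TensorProduct.induction_on with
  | zero => simp
  | add x x' hx hx' => simp only [TensorProduct.add_tmul, map_add, hx, hx', add_mul]
  | tmul p k =>
    induction y using TensorProduct.induction_on with
    | zero => simp
    | add y y' hy hy' => simp only [TensorProduct.tmul_add, map_add, hy, hy', mul_add]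
    | tmul n l =>
      simp [mulCoact_tmul, evalRight_tmul, evalLeft_tmul, TensorProduct.smul_tmul]

/-- If a functional `E` on a comodule `N` is the component of a covector with values in the dual
comodule, then its value on a coinvariant element of `P ⊗ N` transforms in the dual comodule. -/
theorem coinv_evalRight {P N K : Type*} [Ring P] [Algebra ℂ P] [AddCommMonoid N]
    [Module ℂ N] [Ring K] [Algebra ℂ K] {δP : P →ₗ[ℂ] P ⊗[ℂ] K} {δN : N →ₗ[ℂ] N ⊗[ℂ] K}
    {ι : Type*} [Fintype ι] {E : ι → N →ₗ[ℂ] ℂ} {t : ι → K} {F : N →ₗ[ℂ] ℂ}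
    (h : ∀ n, evalLeft F (δN n) = ∑ i, E i n • t i) {ω : P ⊗[ℂ] N}
    (hω : ω ∈ coinv (tensorCoact δP δN)) :
    ∑ i, δP (evalRight (E i) ω) * (1 ⊗ₜ t i) = evalRight F ω ⊗ₜ 1 := by
  have key : ∀ ω, LinearMap.rTensor K (evalRight F) (tensorCoact δP δN ω) =
      ∑ i, δP (evalRight (E i) ω) * (1 ⊗ₜ t i) := by
    intro ω
    induction ω using TensorProduct.induction_on with
    | zero => simp
    | add x y hx hy => simp only [map_add, hx, hy, add_mul, Finset.sum_add_distrib]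
    | tmul p n =>
      simp only [tensorCoact_tmul, rTensor_evalRight_mulCoact, h, TensorProduct.tmul_sum,
        Finset.mul_sum, evalRight_tmul, map_smul, TensorProduct.tmul_smul, smul_mul_assoc,
        mul_smul_comm]
  rw [← key, mem_coinv.1 hω, LinearMap.rTensor_tmul]

/-- The functionals dual to the three basis vectors of `V~_1`: the covectors of `x~x~`, `y~y~` and
`x~y~ + q y~x~`. -/
noncomputable def spin1Fun (q : ℝ) : Fin 3 → C2 ⊗[ℂ] C2 →ₗ[ℂ] ℂ :=
  ![coord2 0 0, coord2 1 1, coord2 0 1 + (q : ℂ) • coord2 1 0]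

theorem evalLeft_tensorCoact_triCoactW (hq : 0 < q) (g : C2 ⊗[ℂ] C2 →ₗ[ℂ] ℂ) (j l j' l' : Fin 2) :
    evalLeft (funW q g) (tensorCoact (triCoactW hq) (triCoactW hq)
      ((e2 j ⊗ₜ e2 l) ⊗ₜ (e2 j' ⊗ₜ e2 l'))) =
    spin0Fun q (e2 l ⊗ₜ e2 l') • (g (e2 0 ⊗ₜ e2 0) • (triMatInv q 0 j * triMatInv q 0 j') +
      g (e2 0 ⊗ₜ e2 1) • (triMatInv q 0 j * triMatInv q 1 j') +
      g (e2 1 ⊗ₜ e2 0) • (triMatInv q 1 j * triMatInv q 0 j') +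
      g (e2 1 ⊗ₜ e2 1) • (triMatInv q 1 j * triMatInv q 1 j')) := by
  simp only [tensorCoact_tmul, triCoactW_e2, TensorProduct.add_tmul, TensorProduct.tmul_add,
    map_add, mulCoact_tmul, evalLeft_tmul, funW_tmul]
  module

/-- H acts through its counit, so the factor `spin0Fun` splits off and only the four pairs of basis
vectors of V~_{1/2} have to be checked. -/
theorem evalLeft_funW (hq : 0 < q) {g : C2 ⊗[ℂ] C2 →ₗ[ℂ] ℂ} {t : Fin 3 → M2}
    (h : ∀ j j', g (e2 0 ⊗ₜ e2 0) • (triMatInv q 0 j * triMatInv q 0 j') +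
      g (e2 0 ⊗ₜ e2 1) • (triMatInv q 0 j * triMatInv q 1 j') +
      g (e2 1 ⊗ₜ e2 0) • (triMatInv q 1 j * triMatInv q 0 j') +
      g (e2 1 ⊗ₜ e2 1) • (triMatInv q 1 j * triMatInv q 1 j') =
        ∑ i, spin1Fun q i (e2 j ⊗ₜ e2 j') • t i) (n : W ⊗[ℂ] W) :
    evalLeft (funW q g) (tensorCoact (triCoactW hq) (triCoactW hq) n) =
      ∑ i, funW q (spin1Fun q i) n • t i := by
  suffices h : evalLeft (funW q g) ∘ₗ tensorCoact (triCoactW hq) (triCoactW hq) =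
      ∑ i, (funW q (spin1Fun q i)).smulRight (t i) by
    simpa using LinearMap.congr_fun h n
  let B := (Pi.basisFun ℂ (Fin 2)).tensorProduct (Pi.basisFun ℂ (Fin 2))
  refine (B.tensorProduct B).ext fun p => ?_
  rcases p with ⟨⟨a, b⟩, ⟨c, d⟩⟩
  simp only [Module.Basis.tensorProduct_apply, B, basisFun_eq_e2, LinearMap.comp_apply,
    evalLeft_tensorCoact_triCoactW, h, LinearMap.sum_apply, LinearMap.smulRight_apply, funW_tmul,
    Finset.smul_sum, smul_smul, mul_comm (spin0Fun q _)]

/-- The coefficients are d², b² and the mixed product d·(-q b) in the representation. The last one,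
-E₁₂, is non-zero: it links the extremal functional to the one of weight zero. -/
theorem evalLeft_spin1Fun_zero (hq : 0 < q) (n : W ⊗[ℂ] W) :
    evalLeft (funW q (spin1Fun q 0)) (tensorCoact (triCoactW hq) (triCoactW hq) n) =
      ∑ i, funW q (spin1Fun q i) n •
        (![!![(q : ℂ)⁻¹ ^ 2, 0; 0, 1], 0, !![0, -1; 0, 0]] : Fin 3 → M2) i := by
  have h0 : (q : ℂ) ≠ 0 := Complex.ofReal_ne_zero.2 hq.ne'
  refine evalLeft_funW hq (fun a c => ?_) n
  rw [Fin.sum_univ_three]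
  fin_cases a <;> fin_cases c <;> ext i j <;> fin_cases i <;> fin_cases j <;>
    simp [spin1Fun, coord2_e2, triMatInv, h0, pow_two, -Complex.coe_smul]

/-- The first coefficient vanishes because c acts by zero; the diagonal coefficient of the weight
zero vector is 1. -/
theorem evalLeft_spin1Fun_two (hq : 0 < q) (n : W ⊗[ℂ] W) :
    evalLeft (funW q (spin1Fun q 2)) (tensorCoact (triCoactW hq) (triCoactW hq) n) =
      ∑ i, funW q (spin1Fun q i) n •
        (![0, !![0, -(q : ℂ) - q ^ 3; 0, 0], 1] : Fin 3 → M2) i := by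
  have h0 : (q : ℂ) ≠ 0 := Complex.ofReal_ne_zero.2 hq.ne'
  refine evalLeft_funW hq (fun a c => ?_) n
  rw [Fin.sum_univ_three]
  fin_cases a <;> fin_cases c <;> ext i j <;> fin_cases i <;> fin_cases j <;>
    simp [spin1Fun, coord2_e2, triMatInv, h0, -Complex.coe_smul]
  ring

/-- For a coinvariant element, the component in `P ⊗ (V~_1 ⊗ V_0)` vanishes as soon as its extremal
weight parts vanish. -/
theorem lTensor_funW_two_eq_zero (hq : 0 < q) {ω : Spq q ⊗[ℂ] (W ⊗[ℂ] W)} (hω : ω ∈ coinvS4 q)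
    (h0 : evalRight (funW q (spin1Fun q 0)) ω = 0) (h1 : evalRight (funW q (spin1Fun q 1)) ω = 0) :
    evalRight (funW q (spin1Fun q 2)) ω = 0 := by
  let δ : Spq q →ₗ[ℂ] Spq q ⊗[ℂ] M2 :=
    TensorProduct.map LinearMap.id (triRepHH hq).toLinearMap ∘ₗ (coactSp q).toLinearMap
  have hω' : ω ∈ coinv (tensorCoact δ (tensorCoact (triCoactW hq) (triCoactW hq))) := by
    have hW : triCoactW hq ∘ₗ LinearMap.id =
      TensorProduct.map LinearMap.id (triRepHH hq).toLinearMap ∘ₗ coactW q := rfl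
    have h : TensorProduct.map LinearMap.id (TensorProduct.map LinearMap.id LinearMap.id) ω ∈
        coinv (tensorCoact δ (tensorCoact (triCoactW hq) (triCoactW hq))) :=
      map_mem_coinv (tensorCoact_map (δM' := δ) (f := LinearMap.id) rfl (tensorCoact_map hW hW)) hω
    rwa [TensorProduct.map_id, TensorProduct.map_id] at h
  have e0 := coinv_evalRight (evalLeft_spin1Fun_zero hq) hω'
  have e2 := coinv_evalRight (evalLeft_spin1Fun_two hq) hω'
  -- With Z the value of weight zero, `e0` now reads δ(Z)(1 ⊗ -E₁₂) = 0, and `e2` reads δ(Z) = Z ⊗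
  -- 1.
  simp only [Fin.sum_univ_three, h0, h1, map_zero, zero_mul, zero_add,
    TensorProduct.zero_tmul] at e0 e2
  have e2' : δ (evalRight (funW q (spin1Fun q 2)) ω) =
      evalRight (funW q (spin1Fun q 2)) ω ⊗ₜ[ℂ] (1 : M2) := by
    rw [← e2]
    exact (mul_one _).symm
  rw [e2', Algebra.TensorProduct.tmul_mul_tmul, mul_one, one_mul] at e0
  -- Together they give Z ⊗ (-E₁₂) = 0; the upper right entry is -Z.
  have := congrArg (evalRight (Matrix.entryLinearMap ℂ ℂ (0 : Fin 2) (1 : Fin 2))) e0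
  simpa [evalRight_tmul] using this

end Representation

/-! ### The component in `V~_0 ⊗ V_1` -/

section AntiSelfDual
variable {q : ℝ}

/-- The coordinate functionals of the basis `(e_i ⊗ e_j) ⊗ (e_k ⊗ e_l)`. -/
noncomputable def coord4 (i j k l : Fin 2) : (C2 ⊗[ℂ] C2) ⊗[ℂ] (C2 ⊗[ℂ] C2) →ₗ[ℂ] ℂ :=
  LinearMap.mul' ℂ ℂ ∘ₗ TensorProduct.map (coord2 i j) (coord2 k l)

theorem coord4_tmul (i j k l : Fin 2) (u v : C2 ⊗[ℂ] C2) :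
    coord4 i j k l (u ⊗ₜ v) = coord2 i j u * coord2 k l v := by
  simp [coord4]

theorem sum_coord4 (z : (C2 ⊗[ℂ] C2) ⊗[ℂ] (C2 ⊗[ℂ] C2)) :
    z = ∑ i, ∑ j, ∑ k, ∑ l, coord4 i j k l z • ((e2 i ⊗ₜ e2 j) ⊗ₜ (e2 k ⊗ₜ e2 l)) := by
  induction z using TensorProduct.induction_on with
  | zero => simp
  | add x y hx hy =>
    simp only [map_add, add_smul, Finset.sum_add_distrib]
    rw [← hx, ← hy]
  | tmul u v =>
    have h : ∀ u : C2 ⊗[ℂ] C2, ∑ i, ∑ j, coord2 i j u • (e2 i ⊗ₜ[ℂ] e2 j) = u := fun u =>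
      (by simpa only [Fin.sum_univ_two] using (sum_coord2 u).symm)
    conv_lhs => rw [← h u, ← h v]
    simp only [coord4_tmul, TensorProduct.sum_tmul]
    simp only [TensorProduct.tmul_sum, TensorProduct.smul_tmul_smul]

theorem funW_eq_coord4 (i j : Fin 2) (w : W ⊗[ℂ] W) : funW q (coord2 i j) w =
    coord4 i j 0 1 (midFlip w) - q * coord4 i j 1 0 (midFlip w) := by
  suffices LinearMap.mul' ℂ ℂ ∘ₗ TensorProduct.map (coord2 i j) (spin0Fun q) =
      coord4 i j 0 1 - (q : ℂ) • coord4 i j 1 0 from LinearMap.congr_fun this (midFlip w)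
  refine TensorProduct.ext' fun u v => ?_
  simp [coord4_tmul, spin0Fun, -Complex.coe_smul]
  ring

theorem coord2_braidt (u : C2 ⊗[ℂ] C2) : coord2 0 1 (braidt q u) = zeta q * coord2 1 0 u ∧
    coord2 1 0 (braidt q u) = zeta q * (coord2 0 1 u + sig q * coord2 1 0 u) := by
  constructor
  all_goals
    nth_rw 1 [sum_coord2 u]
    simp [braidt_e2, coord2_e2]
    ring

theorem coord2_braid (u : C2 ⊗[ℂ] C2) : (∀ i, coord2 i i (braid q u) = sqrtq q * coord2 i i u) ∧
    coord2 0 1 (braid q u) = zeta q * (sig q * coord2 0 1 u + coord2 1 0 u) ∧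
    coord2 1 0 (braid q u) = zeta q * coord2 0 1 u := by
  refine ⟨fun i => ?_, ?_, ?_⟩
  · nth_rw 1 [sum_coord2 u]
    fin_cases i <;> simp [braid_e2, coord2_e2, mul_comm]
  all_goals
    nth_rw 1 [sum_coord2 u]
    simp [braid_e2, coord2_e2]
    ring

/-- These are the components of the eigenvalue equation that are needed to solve it in `mem_asdW`.
-/
theorem coord4_map (z : (C2 ⊗[ℂ] C2) ⊗[ℂ] (C2 ⊗[ℂ] C2)) :
    let y := TensorProduct.map (braidt q) (braid q) z
    (∀ i k, coord4 i i k k y = sqrtq q * sqrtq q * coord4 i i k k z) ∧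
    (∀ i, coord4 i i 1 0 y = sqrtq q * zeta q * coord4 i i 0 1 z) ∧
    (∀ k, coord4 0 1 k k y = zeta q * sqrtq q * coord4 1 0 k k z) ∧
    coord4 0 1 1 0 y = zeta q * zeta q * coord4 1 0 0 1 z ∧
    coord4 0 1 0 1 y = zeta q * zeta q * (sig q * coord4 1 0 0 1 z + coord4 1 0 1 0 z) := by
  have hs := @coord2_braidt_diag q
  have key : ∀ {f g : (C2 ⊗[ℂ] C2) ⊗[ℂ] (C2 ⊗[ℂ] C2) →ₗ[ℂ] ℂ},
      (∀ u v, (f ∘ₗ TensorProduct.map (braidt q) (braid q)) (u ⊗ₜ v) = g (u ⊗ₜ v)) →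
      f (TensorProduct.map (braidt q) (braid q) z) = g z := fun h =>
    LinearMap.congr_fun (TensorProduct.ext' h) z
  refine ⟨fun i k => ?_, fun i => ?_, fun k => ?_, ?_, ?_⟩
  · refine key (g := (sqrtq q * sqrtq q) • coord4 i i k k) fun u v => ?_
    simp only [LinearMap.comp_apply, TensorProduct.map_tmul, coord4_tmul, LinearMap.smul_apply,
      hs, (coord2_braid v).1, smul_eq_mul]
    ring
  · refine key (g := (sqrtq q * zeta q) • coord4 i i 0 1) fun u v => ?_
    simp only [LinearMap.comp_apply, TensorProduct.map_tmul, coord4_tmul, LinearMap.smul_apply,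
      hs, (coord2_braid v).2, smul_eq_mul]
    ring
  · refine key (g := (zeta q * sqrtq q) • coord4 1 0 k k) fun u v => ?_
    simp only [LinearMap.comp_apply, TensorProduct.map_tmul, coord4_tmul, LinearMap.smul_apply,
      (coord2_braidt u).1, (coord2_braid v).1, smul_eq_mul]
    ring
  · refine key (g := (zeta q * zeta q) • coord4 1 0 0 1) fun u v => ?_
    simp only [LinearMap.comp_apply, TensorProduct.map_tmul, coord4_tmul, LinearMap.smul_apply,
      (coord2_braidt u).1, (coord2_braid v).2, smul_eq_mul]
    ring
  · refine key (g := (zeta q * zeta q) • (sig q • coord4 1 0 0 1 + coord4 1 0 1 0)) fun u v => ?_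
    simp only [LinearMap.comp_apply, TensorProduct.map_tmul, coord4_tmul, LinearMap.smul_apply,
      (coord2_braidt u).1, (coord2_braid v).2, smul_eq_mul, LinearMap.add_apply]
    ring

theorem mem_eigen {V : Type*} [AddCommMonoid V] [Module ℂ V] {f : V →ₗ[ℂ] V} {c : ℂ} {v : V} :
    v ∈ eigen f c ↔ f v = c • v := Iff.rfl

theorem mem_spin0t (hq : 0 < q) :
    e2 0 ⊗ₜ[ℂ] e2 1 + (-(q : ℂ)⁻¹) • (e2 1 ⊗ₜ[ℂ] e2 0) ∈ spin0t q := by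
  have h0 := sqrtq_ne_zero hq
  rw [spin0t, mem_eigen]
  simp only [map_add, map_smul, braidt_e2]
  match_scalars <;> simp only [zeta, sig, ← sqrtq_sq hq] <;> field_simp; ring

theorem mem_spin1 (hq : 0 < q) (a b c : ℂ) : a • (e2 0 ⊗ₜ[ℂ] e2 0) + b • (e2 1 ⊗ₜ[ℂ] e2 1) +
    c • ((q : ℂ) • (e2 0 ⊗ₜ[ℂ] e2 1) + e2 1 ⊗ₜ[ℂ] e2 0) ∈ spin1 q := by
  have h0 := sqrtq_ne_zero hq
  rw [spin1, mem_eigen]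
  simp only [map_add, map_smul, braid_e2]
  match_scalars <;> first | ring1 | (simp only [zeta, sig, ← sqrtq_sq hq]; field_simp <;> ring1)

/-- The functionals vanish on V~_0 ⊗ V_1 and separate the points of V~_1 ⊗ V_0. In coordinates, the
eigenvalue equation and the three conditions leave three free parameters, those of V_1. -/
theorem mem_asdW (hq : 0 < q) {w : W ⊗[ℂ] W} (hw : w ∈ asymW q)
    (h : ∀ i, funW q (spin1Fun q i) w = 0) : w ∈ asdW q := by
  have hz : TensorProduct.map (braidt q) (braid q) (midFlip w) = -(q : ℂ)⁻¹ • midFlip w := by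
    have : midFlip.symm (TensorProduct.map (braidt q) (braid q) (midFlip w)) =
      -(q : ℂ)⁻¹ • w := hw
    rw [LinearEquiv.symm_apply_eq] at this
    rw [this, map_smul]
  have h0 : funW q (coord2 0 0) w = 0 := h 0
  have h1 : funW q (coord2 1 1) w = 0 := h 1
  have h2 : funW q (coord2 0 1) w + q * funW q (coord2 1 0) w = 0 := by
    have e : funW q (spin1Fun q 2) = funW q (coord2 0 1) + (q : ℂ) • funW q (coord2 1 0) := by
      simp only [funW, spin1Fun, Matrix.cons_val, TensorProduct.map_add_left,
        TensorProduct.map_smul_left, LinearMap.add_comp, LinearMap.comp_add, LinearMap.smul_comp,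
        LinearMap.comp_smul]
    simpa [e, -Complex.coe_smul] using h 2
  have hc := coord4_map (q := q) (midFlip w)
  rw [funW_eq_coord4] at h0 h1 h2
  rw [funW_eq_coord4] at h2
  refine ⟨midFlip w, ?_, midFlip.symm_apply_apply w⟩
  rw [hz] at hc
  generalize midFlip w = z at *
  simp only [map_smul, smul_eq_mul] at hc
  obtain ⟨c1, c2, c3, c4, c5⟩ := hc
  have hq' : (q : ℂ) ≠ 0 := Complex.ofReal_ne_zero.2 hq.ne'
  have hq2 : (q : ℂ) ^ 2 + 1 ≠ 0 := by
    have : ((q ^ 2 + 1 : ℝ) : ℂ) ≠ 0 := Complex.ofReal_ne_zero.2 (by positivity)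
    simpa using this
  have hs := sqrtq_ne_zero hq
  have hss : sqrtq q * sqrtq q = q := by rw [← pow_two, sqrtq_sq hq]
  have hsz : sqrtq q * zeta q = 1 := mul_inv_cancel₀ hs
  have hzz : zeta q * zeta q = (q : ℂ)⁻¹ := by rw [zeta, ← mul_inv, hss]
  rw [mul_comm (zeta q) (sqrtq q)] at c3
  simp only [hss, hsz, hzz, sig] at c1 c2 c3 c4 c5
  -- On these coordinates Φ acts by q, which differs from -q⁻¹.
  have d1 : ∀ i k, coord4 i i k k z = 0 := fun i k => by
    refine (mul_eq_zero.1 (?_ : ((q : ℂ) ^ 2 + 1) * _ = 0)).resolve_left hq2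
    have := c1 i k
    field_simp at this
    linear_combination -this
  -- The eigenvalue equation gives z_{ii10} = -q z_{ii01}, the functional z_{ii01} = q z_{ii10}; the
  -- determinant q² + 1 of this system is non-zero.
  have d2 : ∀ i, coord4 i i 0 1 z - q * coord4 i i 1 0 z = 0 → coord4 i i 0 1 z = 0 ∧
      coord4 i i 1 0 z = 0 := fun i hi => by
    have := c2 i
    field_simp at this
    have h10 : coord4 i i 0 1 z = 0 := by
      refine (mul_eq_zero.1 (?_ : ((q : ℂ) ^ 2 + 1) * _ = 0)).resolve_left hq2
      linear_combination hi - q * this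
    refine ⟨h10, ?_⟩
    rw [h10] at this
    linear_combination -this
  have d3 : ∀ k, coord4 1 0 k k z = -(q : ℂ)⁻¹ * coord4 0 1 k k z := fun k => by
    linear_combination -c3 k
  have d4 : coord4 1 0 0 1 z = - coord4 0 1 1 0 z := by
    field_simp at c4
    linear_combination -c4
  have d5 : coord4 1 0 1 0 z = -(q : ℂ)⁻¹ * coord4 0 1 1 0 z := by
    rw [← sub_eq_zero]
    refine (mul_eq_zero.1 (?_ : ((q : ℂ) ^ 2 + 1) * _ = 0)).resolve_left hq2
    rw [d4] at c5 h2
    field_simp at c5 ⊢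
    linear_combination -c5 - q * h2
  have d6 : coord4 0 1 0 1 z = q * coord4 0 1 1 0 z := by
    rw [d4, d5] at h2
    field_simp at h2
    linear_combination h2
  -- The left factor is the generator of V~_0; the right one is a general element of V_1, with the
  -- three remaining coordinates as coefficients.
  have e : z = (e2 0 ⊗ₜ[ℂ] e2 1 + (-(q : ℂ)⁻¹) • (e2 1 ⊗ₜ[ℂ] e2 0)) ⊗ₜ
      (coord4 0 1 0 0 z • (e2 0 ⊗ₜ[ℂ] e2 0) + coord4 0 1 1 1 z • (e2 1 ⊗ₜ[ℂ] e2 1) +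
        coord4 0 1 1 0 z • ((q : ℂ) • (e2 0 ⊗ₜ[ℂ] e2 1) + e2 1 ⊗ₜ[ℂ] e2 0)) := by
    conv_lhs => rw [sum_coord4 z]
    simp only [Fin.sum_univ_two, d1, d2 0 h0, d2 1 h1, d3, d4, d5, d6, TensorProduct.add_tmul,
      TensorProduct.tmul_add, TensorProduct.tmul_smul, ← TensorProduct.smul_tmul']
    match_scalars <;> field_simp
  rw [e]
  exact ⟨⟨_, mem_spin0t hq⟩ ⊗ₜ ⟨_, mem_spin1 hq _ _ _⟩, rfl⟩

/-! ### Passage to coefficients in P, and the two implications -/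

theorem mem_tensorSub_of_evalRight_eq_zero {P V : Type*} [AddCommGroup P] [Module ℂ P]
    [AddCommGroup V] [Module ℂ V] {U U' : Submodule ℂ V} {ι : Type*} [Fintype ι]
    {E : ι → V →ₗ[ℂ] ℂ} (hU : ∀ v ∈ U, (∀ i, E i v = 0) → v ∈ U') {ω : P ⊗[ℂ] V}
    (hω : ω ∈ tensorSub P U) (h : ∀ i, evalRight (E i) ω = 0) : ω ∈ tensorSub P U' := by
  classical
  obtain ⟨ω, rfl⟩ := hω
  let f : U →ₗ[ℂ] ι → ℂ := LinearMap.pi fun i => E i ∘ₗ U.subtype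
  have hf : LinearMap.lTensor P f ω = 0 := by
    apply (TensorProduct.piScalarRight ℂ ℂ P ι).injective
    rw [map_zero]
    funext i
    rw [Pi.zero_apply, ← h i]
    clear h
    induction ω using TensorProduct.induction_on with
    | zero => simp
    | add x y hx hy => simp only [map_add, Pi.add_apply, hx, hy]
    | tmul p v => simp [evalRight_tmul, f]
  -- As P is flat over ℂ, the kernel of id ⊗ f is the image of P ⊗ ker f.
  obtain ⟨ω', rfl⟩ := (Module.Flat.lTensor_exact P (LinearMap.exact_subtype_ker_map f) ω).1 hf
  let g : LinearMap.ker f →ₗ[ℂ] U' :=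
    (U.subtype ∘ₗ (LinearMap.ker f).subtype).codRestrict _ fun x =>
      hU _ x.1.2 fun i => congrFun x.2 i
  refine ⟨LinearMap.lTensor P g ω', ?_⟩
  rw [← LinearMap.lTensor_comp_apply, ← LinearMap.lTensor_comp_apply]
  rfl

theorem mem_tensorSub_asdW (hq : 0 < q) {P : Type*} [AddCommGroup P] [Module ℂ P]
    {ω : P ⊗[ℂ] (W ⊗[ℂ] W)} (hω : ω ∈ tensorSub P (asymW q))
    (h : ∀ i, evalRight (funW q (spin1Fun q i)) ω = 0) : ω ∈ tensorSub P (asdW q) := by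
  have key := @mem_tensorSub_of_evalRight_eq_zero P (W ⊗[ℂ] W) _ _ _ _ (asymW q) (asdW q)
    (Fin 3) _ (fun i => funW q (spin1Fun q i)) (fun _ h1 h2 => mem_asdW hq h1 h2) ω
  have key' := key hω
  exact key' h

theorem mem_asdFormsS4 (hq0 : 0 < q) (hq1 : q < 1) {ω : Spq q ⊗[ℂ] (W ⊗[ℂ] W)}
    (hω : ω ∈ twoFormsS4 q) (h : pushOut q ω ∈ tensorSub (Spq q) (typeVh q 1 0 1)) :
    ω ∈ asdFormsS4 q := by
  have h0 : evalRight (funW q (spin1Fun q 0)) ω = 0 :=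
    evalRight_eq_zero.2 (lTensor_funW_eq_zero hq0 hq1 h 0)
  have h1 : evalRight (funW q (spin1Fun q 1)) ω = 0 :=
    evalRight_eq_zero.2 (lTensor_funW_eq_zero hq0 hq1 h 1)
  have h2 : evalRight (funW q (spin1Fun q 2)) ω = 0 := lTensor_funW_two_eq_zero hq0 hω.1 h0 h1
  refine ⟨hω.1, mem_tensorSub_asdW hq0 hω.2 ?_⟩
  exact Fin.forall_fin_succ.2 ⟨h0, Fin.forall_fin_two.2 ⟨h1, h2⟩⟩

theorem pushOut_mem_tensorSub_typeVh (hq : 0 < q) {ω : Spq q ⊗[ℂ] (W ⊗[ℂ] W)}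
    (hω : ω ∈ asdFormsS4 q) : pushOut q ω ∈ tensorSub (Spq q) (typeVh q 1 0 1) :=
  map_mem_tensorSub (asdW_le_comap_typeVh hq) hω.2

end AntiSelfDual
end QTwistor

theorem mainTheorem5 (q : ℝ) (hq0 : 0 < q) (hq1 : q < 1)
    (ω : TensorProduct ℂ (QTwistor.Spq q) (TensorProduct ℂ QTwistor.W QTwistor.W))
    (hω : ω ∈ QTwistor.twoFormsS4 q) :
    QTwistor.pushOut q ω ∈ QTwistor.twoFormsCP3 q ∧
      (ω ∈ QTwistor.asdFormsS4 q ↔ QTwistor.pushOut q ω ∈ QTwistor.typeFormsCP3 q 1 0 1) := by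
  have hp := QTwistor.pushOut_mem_twoFormsCP3 hq0 hω.1
  exact ⟨hp, fun h => ⟨hp, QTwistor.pushOut_mem_tensorSub_typeVh hq0 h⟩,
    fun h => QTwistor.mem_asdFormsS4 hq0 hq1 hω h.2⟩
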